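/- Let $N\ge 2$. There are $2N$ items with unknown parameters $u=(u_1,\dots,u_{2N})\in(0,1)^{2N}$. In every round a (possibly randomized) algorithm chooses, from its past observations, a maximal matching of the items, i.e. a partition of $\{1,\dots,2N\}$ into $N$ pairs, and observes for each chosen pair $\{i,j\}$ an independent Gaussian reward with mean $u_iu_j$ and variance $1$. At a stopping time $\tau_\delta$ (the number of rounds) it stops and returns a matching. The algorithm is called $\delta$-PAC if, for every $u\in(0,1)^{2N}$ (with entries in any order) for which the matching maximizing $\sum_{\{i,j\}\in m}u_iu_j$ is unique, it stops and returns this matching with probability at least $1-\delta$. For $u_1\ge u_2\ge\dots\ge u_{2N}$ put $\Delta_{2k,2k+1}=u_{2k}-u_{2k+1}$ for $1\le k\le N-1$, and $\Delta_{2k}=u_{2k}-u_{2k+1}$ and $\Delta_{2k+1}=u_{2k}-u_{2k+1}$ for $1\le k\le N-1$, $\Delta_1=u_1-u_3$, $\Delta_{2N}=u_{2N-2}-u_{2N}$. Then for every $\delta_0\in(0,1/2)$ there is a constant $c>0$, depending only on $\delta_0$ (so universal once, say, $\delta_0=1/4$ is fixed), such that for all $N\ge2$, all $\delta\in(0,\delta_0]$,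 every $\delta$-PAC algorithm and every $u\in(0,1)^{2N}$ with $u_1\ge\dots\ge u_{2N}$, $$\mathbb E_u[\tau_\delta]\ \ge\ c\sum_{i\in\{1,\dots,2N\}:\,\Delta_i>0}\frac{1}{\sum_{j=1}^{2N}u_j^2}\,\frac1{\Delta_i^2}\,\log(1/\delta).$$ Moreover, if $s\in\{2,\dots,N-1\}$ minimizes $\Delta_{2k,2k+1}$ over $k\in\{2,\dots,N-1\}$ (in particular, if $s\ge 2$ minimizes it over $\{1,\dots,N-1\}$), then $$\mathbb E_u[\tau_\delta]\ \ge\ \frac{c}{(u_1^2+u_2^2)\,\Delta_{2s,2s+1}^2}\,\log(1/\delta),$$ and if $s=1$ minimizes $\Delta_{2k,2k+1}$ over $k\in\{1,\dots,N-1\}$, then $$\mathbb E_u[\tau_\delta]\ \ge\ \frac{c}{u_1^2\,\Delta_{2,3}^2}\,\log(1/\delta).$$ (In the last two bounds the right-hand side is read as $+\infty$ if the gap in the denominator is $0$.) -/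

import Mathlib

open MeasureTheory ProbabilityTheory
open scoped ENNReal

noncomputable section

namespace MatchingBandit

/-- A maximal matching of `2N` items, encoded by its partner map: a fixed-point-free involution
of the items. The pairs of the matching are the `{i, m i}`. -/
abbrev MaxMatching (N : ℕ) : Type :=
  {m : Fin (2 * N) → Fin (2 * N) // Function.Involutive m ∧ ∀ i, m i ≠ i}

/-- The mean reward of a pair `{i, j}`, the entry `u i * u j` of the rank-one matrix `u uᵀ`. -/
def meanReward {N : ℕ} (u : Fin (2 * N) → ℝ) : Sym2 (Fin (2 * N)) → ℝ :=
  Sym2.lift ⟨fun i j => u i * u j, fun i j => mul_comm (u i) (u j)⟩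

/-- The expected reward of a matching, i.e. the sum of `u i * u j` over its pairs `{i, j}`
(the sum over all items counts every pair twice). -/
def matchingReward {N : ℕ} (u : Fin (2 * N) → ℝ) (m : MaxMatching N) : ℝ :=
  (∑ i, u i * u (m.1 i)) / 2

/-- `m` is the unique matching of maximal expected reward. -/
def IsUniqueOptimal {N : ℕ} (u : Fin (2 * N) → ℝ) (m : MaxMatching N) : Prop :=
  ∀ m' : MaxMatching N, m' ≠ m → matchingReward u m' < matchingReward u m

/-- The observations of the first `t` rounds. In each round one number is recorded per item:
the reward of the pair this item belonged to. -/
abbrev History (N t : ℕ) : Type := Fin t → Fin (2 * N) → ℝ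

/-- A (possibly randomized) sequential algorithm. Its internal randomness is a seed in `S`,
drawn once; as the matchings chosen so far are functions of the seed and of the earlier
observations, they need not be listed in the history. -/
structure Algorithm (N : ℕ) (S : Type*) [MeasurableSpace S] where
  /-- the matching sampled in round `t + 1`, given the seed and the first `t` observations -/
  sample : (t : ℕ) → S × History N t → MaxMatching N
  measurable_sample : ∀ t, Measurable (sample t)
  /-- the situations in which the algorithm stops after `t` rounds -/
  halted : (t : ℕ) → Set (S × History N t)
  measurableSet_halted : ∀ t, MeasurableSet (halted t)
  /-- the matching returned if the algorithm stops after `t` rounds -/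
  output : (t : ℕ) → S × History N t → MaxMatching N
  measurable_output : ∀ t, Measurable (output t)

/-- Outcomes: the seed, and the table of the rewards `X t {i, j}` of all pairs in all rounds
(of which an algorithm sees only the pairs it samples). -/
abbrev Outcome (N : ℕ) (S : Type*) : Type _ := S × (ℕ → Sym2 (Fin (2 * N)) → ℝ)

/-- The law of the outcome for the instance `u`: the rewards are independent Gaussian variables
of variance `1` and mean `u i * u j`, independent of the seed, which has law `ρ`. -/
def outcomeLaw {N : ℕ} {S : Type*} [MeasurableSpace S] (ρ : Measure S)
    (u : Fin (2 * N) → ℝ) : Measure (Outcome N S) :=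
  ρ.prod (Measure.infinitePi fun _ : ℕ => Measure.pi fun e => gaussianReal (meanReward u e) 1)

namespace Algorithm

variable {N : ℕ} {S : Type*} [MeasurableSpace S]

/-- What the algorithm has seen after `t` rounds (if it did not finish before). -/
def hist (A : Algorithm N S) (ω : Outcome N S) : (t : ℕ) → History N t
  | 0 => Fin.elim0
  | t + 1 => Fin.snoc (α := fun _ => Fin (2 * N) → ℝ) (A.hist ω t)
      (fun i => ω.2 t s(i, (A.sample t (ω.1, A.hist ω t)).1 i))

/-- The stopping time: the number of rounds (sampled matchings) before the algorithm stops. -/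
def tau (A : Algorithm N S) (ω : Outcome N S) : ℕ∞ :=
  ⨅ (t : ℕ) (_ : (ω.1, A.hist ω t) ∈ A.halted t), (t : ℕ∞)

/-- The event that the algorithm stops and returns the matching `m`. -/
def returns (A : Algorithm N S) (m : MaxMatching N) : Set (Outcome N S) :=
  {ω | ∃ t : ℕ, A.tau ω = t ∧ A.output t (ω.1, A.hist ω t) = m}

/-- The expected number of rounds for the instance `u` (possibly infinite). -/
def expectedTau (A : Algorithm N S) (ρ : Measure S) (u : Fin (2 * N) → ℝ) : ℝ≥0∞ :=
  ∫⁻ ω, ((A.tau ω : ℕ∞) : ℝ≥0∞) ∂(outcomeLaw ρ u)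

/-- `δ`-PAC: for every parameter vector in `(0,1)^(2N)`, in whatever order, that has a unique
optimal matching, this matching is returned with probability at least `1 - δ`. -/
def IsDeltaPAC (A : Algorithm N S) (ρ : Measure S) (δ : ℝ) : Prop :=
  ∀ u : Fin (2 * N) → ℝ, (∀ i, u i ∈ Set.Ioo (0 : ℝ) 1) →
    ∀ m : MaxMatching N, IsUniqueOptimal u m →
      ENNReal.ofReal (1 - δ) ≤ outcomeLaw ρ u (A.returns m)

end Algorithm

/-- The parameter `u_k`, for `k = 1, …, 2N`. -/
def param {N : ℕ} (u : Fin (2 * N) → ℝ) (k : ℕ) : ℝ :=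
  if h : 1 ≤ k ∧ k ≤ 2 * N then u ⟨k - 1, by omega⟩ else 0

/-- `Δ_{2k,2k+1} = u_{2k} - u_{2k+1}`, the gap between the pairs `k` and `k + 1`. -/
def pairGap {N : ℕ} (u : Fin (2 * N) → ℝ) (k : ℕ) : ℝ :=
  param u (2 * k) - param u (2 * k + 1)

/-- The gap `Δ_i` of the item `i = 1, …, 2N`: the distance of `u_i` to the closest item of the
pair after (`i` even) or before (`i` odd) the pair of `i`; for the first and the last item,
where this pair does not exist, the closest item of the only adjacent pair is taken. -/
def gap {N : ℕ} (u : Fin (2 * N) → ℝ) (i : ℕ) : ℝ :=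
  if i = 1 then param u 1 - param u 3
  else if i = 2 * N then param u (2 * N - 2) - param u (2 * N)
  else if Even i then param u i - param u (i + 1)
  else param u (i - 1) - param u i

end MatchingBandit

end

/-! The proof is a change-of-measure argument. Suppose the expected stopping time at `u` is finite,
and let `v` be a vector with another optimal matching. A `δ`-PAC algorithm returns that matching
with probability at most 1/2 under `u` and at least `1 - δ` under `v`. By data processing
(`IsAdaptive.le_sum_divergence`), the expected log-likelihood ratio of its observations is then at
least `kl(1/2, δ) = -log(4δ(1-δ))/2`, which is of order `log(1/δ)`. This expectation is a sum over
matchings: the expected count of each matching times the squared mean differences of its pairs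
(`divergence_lower_bound`).

For an item `a`, take `v` to be `u` with `u a` moved by the gap of `a`. Then `v` has a tie between
two pairs and can be sorted in a way that yields a different matching (`exists_crossing`). Ties are
handled by perturbing `v` slightly and passing to the limit. Only the pair of `a` changes its mean,
so `kl(1/2, δ) ≤ gap² · ∑ m, E[count m] · u(m a)²` (`item_lower_bound`).

Dividing by `gap²` and summing over `a` gives the first bound: every matching is a permutation of
the items, so each round contributes exactly `∑ j, u j²`. For a single item `2s`, the estimate `u(m
a) ≤ u_1` gives the other two bounds. The constant `c` is the one in `kl(1/2, δ) ≥ c log(1/δ)`. -/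

noncomputable section

namespace MatchingBandit

/-! ### Product measures and Gaussian likelihood ratios. -/

/-- Resampling one coordinate of an infinite product measure does not change its law. -/
lemma measurePreserving_update_infinitePi {X : Type*} [MeasurableSpace X] (μ : ℕ → Measure X)
    [∀ n, IsProbabilityMeasure (μ n)] (n : ℕ) :
    MeasurePreserving (fun p : (ℕ → X) × X => Function.update p.1 n p.2)
      ((Measure.infinitePi μ).prod (μ n)) (Measure.infinitePi μ) := by
  have hm : Measurable (fun p : (ℕ → X) × X => Function.update p.1 n p.2) := by
    refine measurable_pi_lambda _ fun k => ?_
    by_cases h : k = n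
    · subst h; simpa using measurable_snd
    · simp only [Function.update_of_ne h]; fun_prop
  refine ⟨hm, Measure.eq_infinitePi μ fun s t ht => ?_⟩
  have hs : MeasurableSet ((s : Set ℕ).pi t) :=
    MeasurableSet.pi s.countable_toSet fun i _ => ht i
  rw [Measure.map_apply hm hs]
  by_cases hn : n ∈ s
  · have : (fun p : (ℕ → X) × X => Function.update p.1 n p.2) ⁻¹' ((s : Set ℕ).pi t) =
        (((s.erase n : Finset ℕ) : Set ℕ).pi t) ×ˢ t n := by
      ext ⟨x, y⟩
      simp only [Set.mem_preimage, Set.mem_pi, Finset.mem_coe, Set.mem_prod, Finset.mem_erase]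
      constructor
      · intro h
        refine ⟨fun i hi => ?_, by simpa using h n hn⟩
        simpa [Function.update_of_ne hi.1] using h i hi.2
      · rintro ⟨h1, h2⟩ i hi
        by_cases h : i = n
        · subst h; simpa using h2
        · simpa [Function.update_of_ne h] using h1 i ⟨h, hi⟩
    rw [this, Measure.prod_prod, Measure.infinitePi_pi _ (fun i _ => ht i),
      Finset.prod_erase_mul _ _ hn]
  · have : (fun p : (ℕ → X) × X => Function.update p.1 n p.2) ⁻¹' ((s : Set ℕ).pi t) =
        ((s : Set ℕ).pi t) ×ˢ Set.univ := by
      ext ⟨x, y⟩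
      simp only [Set.mem_preimage, Set.mem_pi, Finset.mem_coe, Set.mem_prod, Set.mem_univ,
        and_true]
      refine forall₂_congr fun i hi => ?_
      rw [Function.update_of_ne (by rintro rfl; exact hn hi)]
    rw [this, Measure.prod_prod, Measure.infinitePi_pi _ (fun i _ => ht i)]
    simp

/-- The log-likelihood ratio `log (dN(a,1)/dN(b,1))` of two Gaussian laws of variance `1`. -/
def gaussianLLR (a b x : ℝ) : ℝ := (a - b) * (x - (a + b) / 2)

@[fun_prop]
lemma measurable_gaussianLLR (a b : ℝ) : Measurable (gaussianLLR a b) := by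
  unfold gaussianLLR; fun_prop

lemma gaussianReal_withDensity_llr (a b : ℝ) :
    (gaussianReal a 1).withDensity (fun x => ENNReal.ofReal (Real.exp (-gaussianLLR a b x))) =
      gaussianReal b 1 := by
  rw [gaussianReal_of_var_ne_zero a one_ne_zero, gaussianReal_of_var_ne_zero b one_ne_zero,
    ← withDensity_mul _ (measurable_gaussianPDF _ _) (by fun_prop)]
  congr 1
  ext x
  simp only [Pi.mul_apply, gaussianPDF]
  rw [← ENNReal.ofReal_mul (gaussianPDFReal_nonneg _ _ _)]
  congr 1
  simp only [gaussianPDFReal, gaussianLLR, NNReal.coe_one]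
  rw [mul_assoc, ← Real.exp_add]
  congr 2
  ring

lemma integrable_gaussianLLR (a b : ℝ) : Integrable (gaussianLLR a b) (gaussianReal a 1) := by
  have : Integrable (fun x : ℝ => x) (gaussianReal a 1) :=
    (memLp_id_gaussianReal 1).integrable (by simp)
  exact (this.sub (integrable_const _)).const_mul _

lemma integral_gaussianLLR (a b : ℝ) :
    ∫ x, gaussianLLR a b x ∂(gaussianReal a 1) = (a - b) ^ 2 / 2 := by
  have : Integrable (fun x : ℝ => x) (gaussianReal a 1) :=
    (memLp_id_gaussianReal 1).integrable (by simp)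
  simp only [gaussianLLR]
  rw [integral_const_mul, integral_sub this (integrable_const _), integral_id_gaussianReal]
  simp
  ring

section Pi

variable {E : Type*} [Fintype E]

lemma lintegral_pi_prod (μ : E → Measure ℝ) [∀ e, IsProbabilityMeasure (μ e)]
    (f : E → ℝ → ℝ≥0∞) (hf : ∀ e, Measurable (f e)) :
    ∫⁻ y, ∏ e, f e (y e) ∂(Measure.pi μ) = ∏ e, ∫⁻ x, f e x ∂(μ e) := by
  have hi : iIndepFun (fun e (y : E → ℝ) => f e (y e)) (Measure.pi μ) :=
    iIndepFun_pi (X := f) fun e => (hf e).aemeasurable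
  have := lintegral_prod_eq_prod_lintegral_of_indepFun Finset.univ _ hi (fun e => by fun_prop)
  rw [this]
  refine Finset.prod_congr rfl fun e _ => ?_
  exact (measurePreserving_eval μ e).lintegral_comp (hf e)

lemma pi_withDensity_prod (μ : E → Measure ℝ) [∀ e, IsProbabilityMeasure (μ e)]
    (f : E → ℝ → ℝ≥0∞) (hf : ∀ e, Measurable (f e))
    [∀ e, IsProbabilityMeasure ((μ e).withDensity (f e))] :
    Measure.pi (fun e => (μ e).withDensity (f e)) =
      (Measure.pi μ).withDensity (fun y => ∏ e, f e (y e)) := by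
  refine Measure.pi_eq fun s hs => ?_
  rw [withDensity_apply _ (MeasurableSet.univ_pi hs), ← lintegral_indicator
    (MeasurableSet.univ_pi hs)]
  have : ∀ y : E → ℝ, (Set.univ.pi s).indicator (fun y => ∏ e, f e (y e)) y =
      ∏ e, (s e).indicator (f e) (y e) := by
    intro y
    by_cases hy : y ∈ Set.univ.pi s
    · rw [Set.indicator_of_mem hy]
      exact Finset.prod_congr rfl fun e _ => (Set.indicator_of_mem (hy e trivial) _).symm
    · rw [Set.indicator_of_notMem hy]
      simp only [Set.mem_pi, Set.mem_univ, true_imp_iff, not_forall] at hy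
      obtain ⟨e, he⟩ := hy
      exact (Finset.prod_eq_zero (Finset.mem_univ e) (Set.indicator_of_notMem he _)).symm
  simp_rw [this]
  rw [lintegral_pi_prod μ _ fun e => (hf e).indicator (hs e)]
  refine Finset.prod_congr rfl fun e _ => ?_
  rw [withDensity_apply _ (hs e), lintegral_indicator (hs e)]

/-- The integral of a function of the coordinates in `M` does not see the other factors. -/
lemma lintegral_pi_congr_of_dependsOn (μ ν : E → Measure ℝ) [∀ e, IsProbabilityMeasure (μ e)]
    [∀ e, IsProbabilityMeasure (ν e)] (M : Finset E) (h : ∀ e ∈ M, μ e = ν e)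
    (g : (E → ℝ) → ℝ≥0∞) (hg : Measurable g)
    (hdep : ∀ y z : E → ℝ, (∀ e ∈ M, y e = z e) → g y = g z) :
    ∫⁻ y, g y ∂(Measure.pi μ) = ∫⁻ y, g y ∂(Measure.pi ν) := by
  classical
  -- The value 0 outside `M` is arbitrary: `g` factors through the restriction to `M`, where the two
  -- product laws coincide.
  let ext : ((e : M) → ℝ) → E → ℝ := fun z e => if he : e ∈ M then z ⟨e, he⟩ else 0
  have hext : Measurable ext := by
    refine measurable_pi_lambda _ fun e => ?_
    by_cases he : e ∈ M
    · simp only [ext, he, dite_true]; fun_prop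
    · simp only [ext, he, dite_false]; fun_prop
  have hgr : ∀ y, g y = (g ∘ ext) (M.restrict y) := fun y =>
    hdep _ _ fun e he => by simp [ext, he]
  have key : ∀ (κ : E → Measure ℝ) [∀ e, IsProbabilityMeasure (κ e)],
      ∫⁻ y, g y ∂(Measure.pi κ) =
        ∫⁻ z, (g ∘ ext) z ∂(Measure.pi fun e : M => κ e) := by
    intro κ _
    rw [← lintegral_restrict_infinitePi (μ := κ) (hg.comp hext), Measure.infinitePi_eq_pi]
    exact lintegral_congr hgr
  rw [key μ, key ν]
  congr 2
  ext1 e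
  exact h e e.2

/-- Change of measure for a function of finitely many independent Gaussian variables. -/
lemma lintegral_pi_gaussian_change (a b : E → ℝ) (M : Finset E)
    (g : (E → ℝ) → ℝ≥0∞) (hg : Measurable g)
    (hdep : ∀ y z : E → ℝ, (∀ e ∈ M, y e = z e) → g y = g z) :
    ∫⁻ y, g y ∂(Measure.pi fun e => gaussianReal (b e) 1) =
      ∫⁻ y, g y * ∏ e ∈ M, ENNReal.ofReal (Real.exp (-gaussianLLR (a e) (b e) (y e)))
        ∂(Measure.pi fun e => gaussianReal (a e) 1) := by
  classical
  -- Outside `M` the mean `b e` may be replaced by `a e`, so that only the coordinates in `M`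
  -- contribute a density.
  let c : E → ℝ := fun e => if e ∈ M then b e else a e
  rw [lintegral_pi_congr_of_dependsOn _ (fun e => gaussianReal (c e) 1) M
    (fun e he => by simp [c, he]) g hg hdep]
  have hc : (fun e => gaussianReal (c e) 1) = fun e => (gaussianReal (a e) 1).withDensity
      (fun x => ENNReal.ofReal (Real.exp (-gaussianLLR (a e) (c e) x))) := by
    ext1 e; rw [gaussianReal_withDensity_llr]
  have : ∀ e, IsProbabilityMeasure ((gaussianReal (a e) 1).withDensity
      (fun x => ENNReal.ofReal (Real.exp (-gaussianLLR (a e) (c e) x)))) := fun e => by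
    rw [gaussianReal_withDensity_llr]; infer_instance
  rw [hc, pi_withDensity_prod _ _ (fun e => by fun_prop),
    lintegral_withDensity_eq_lintegral_mul _ (by fun_prop) hg]
  refine lintegral_congr fun y => ?_
  rw [Pi.mul_apply, mul_comm]
  congr 1
  rw [← Finset.prod_subset (Finset.subset_univ M)]
  · exact Finset.prod_congr rfl fun e he => by simp [c, he]
  · intro e _ he
    simp [c, he, gaussianLLR]

end Pi

/-! ### Tables of rewards observed adaptively. -/

section Observations

variable {S : Type*} {E : Type*}

/-- Replace the rewards of round `n`. -/
def setRound (n : ℕ) (ω : S × (ℕ → E → ℝ)) (y : E → ℝ) : S × (ℕ → E → ℝ) :=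
  (ω.1, Function.update ω.2 n y)

/-- The outcomes `ω` and `ω'` have the same seed and, in the first `n` rounds, the same rewards
at the places `M s ω` that are observed along `ω`. -/
def ObsAgree (M : ℕ → S × (ℕ → E → ℝ) → Finset E) (n : ℕ) (ω ω' : S × (ℕ → E → ℝ)) : Prop :=
  ω.1 = ω'.1 ∧ ∀ s < n, ∀ e ∈ M s ω, ω.2 s e = ω'.2 s e

lemma ObsAgree.mono {M : ℕ → S × (ℕ → E → ℝ) → Finset E} {m n : ℕ} (hmn : m ≤ n)
    {ω ω' : S × (ℕ → E → ℝ)} (h : ObsAgree M n ω ω') : ObsAgree M m ω ω' :=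
  ⟨h.1, fun s hs => h.2 s (hs.trans_le hmn)⟩

lemma obsAgree_setRound (M : ℕ → S × (ℕ → E → ℝ) → Finset E) (n : ℕ) (ω : S × (ℕ → E → ℝ))
    (y : E → ℝ) : ObsAgree M n ω (setRound n ω y) :=
  ⟨rfl, fun s hs e _ => by simp [setRound, Function.update_of_ne hs.ne]⟩

open Classical in
lemma sum_observed_eq [Fintype E] (M : ℕ → S × (ℕ → E → ℝ) → Finset E) (s : ℕ)
    (f : E → ℝ) (ω : S × (ℕ → E → ℝ)) :
    ∑ e ∈ M s ω, f e = ∑ e, {ω | e ∈ M s ω}.indicator (fun _ => f e) ω := by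
  simp [Set.indicator_apply, Finset.sum_ite_mem]

/-- The log-likelihood ratio of the observations of the first `n` rounds. -/
def obsLLR (M : ℕ → S × (ℕ → E → ℝ) → Finset E) (a b : E → ℝ) (n : ℕ)
    (ω : S × (ℕ → E → ℝ)) : ℝ :=
  ∑ s ∈ Finset.range n, ∑ e ∈ M s ω, gaussianLLR (a e) (b e) (ω.2 s e)

/-- An adaptive choice of the observed places: it depends on earlier observations only. -/
structure IsAdaptive [MeasurableSpace S] (M : ℕ → S × (ℕ → E → ℝ) → Finset E) : Prop where
  congr : ∀ n ω ω', ObsAgree M n ω ω' → M n ω = M n ω'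
  measurableSet_mem : ∀ n e, MeasurableSet {ω | e ∈ M n ω}

/-- The choice for round `s` uses only rounds strictly before `s`. The case `s = n` lets a round be
integrated out with its observed places held fixed. -/
lemma IsAdaptive.eq_setRound [MeasurableSpace S]
    {M : ℕ → S × (ℕ → E → ℝ) → Finset E} (hM : IsAdaptive M) {s n : ℕ} (hs : s ≤ n)
    (ω : S × (ℕ → E → ℝ)) (y : E → ℝ) : M s (setRound n ω y) = M s ω :=
  (hM.congr s _ _ ((obsAgree_setRound M n ω y).mono hs)).symm

lemma IsAdaptive.obsLLR_succ_setRound [MeasurableSpace S]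
    {M : ℕ → S × (ℕ → E → ℝ) → Finset E} (hM : IsAdaptive M) (a b : E → ℝ) (n : ℕ)
    (ω : S × (ℕ → E → ℝ)) (y : E → ℝ) :
    obsLLR M a b (n + 1) (setRound n ω y) =
      obsLLR M a b n ω + ∑ e ∈ M n ω, gaussianLLR (a e) (b e) (y e) := by
  unfold obsLLR
  rw [Finset.sum_range_succ, hM.eq_setRound le_rfl]
  congr 1
  · refine Finset.sum_congr rfl fun s hs => ?_
    have hs := Finset.mem_range.1 hs
    rw [hM.eq_setRound hs.le]
    simp [setRound, Function.update_of_ne hs.ne]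
  · simp [setRound]

end Observations

/-! ### Change of measure and data processing for adaptive observations. -/

section Adaptive

variable {S : Type*} [MeasurableSpace S] {E : Type*} [Fintype E]

/-- The law of a seed and an independent table of independent Gaussian rewards. -/
def rewardLaw (ρ : Measure S) (a : E → ℝ) : Measure (S × (ℕ → E → ℝ)) :=
  ρ.prod (Measure.infinitePi fun _ : ℕ => Measure.pi fun e => gaussianReal (a e) 1)

instance (ρ : Measure S) [IsProbabilityMeasure ρ] (a : E → ℝ) :
    IsProbabilityMeasure (rewardLaw ρ a) := by
  unfold rewardLaw; infer_instance

lemma measurePreserving_setRound (ρ : Measure S) [IsProbabilityMeasure ρ] (a : E → ℝ) (n : ℕ) :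
    MeasurePreserving (fun p : (S × (ℕ → E → ℝ)) × (E → ℝ) => setRound n p.1 p.2)
      ((rewardLaw ρ a).prod (Measure.pi fun e => gaussianReal (a e) 1)) (rewardLaw ρ a) := by
  have h1 := measurePreserving_update_infinitePi
    (fun _ : ℕ => Measure.pi fun e => gaussianReal (a e) 1) n
  have h2 := (MeasurePreserving.id ρ).prod h1
  exact h2.comp (measurePreserving_prodAssoc ρ _ _)

variable {M : ℕ → S × (ℕ → E → ℝ) → Finset E}

lemma IsAdaptive.measurable_obsLLR (hM : IsAdaptive M) (a b : E → ℝ) (n : ℕ) :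
    Measurable (obsLLR M a b n) := by
  classical
  refine Finset.measurable_sum _ fun s _ => ?_
  simp_rw [sum_observed_eq]
  refine Finset.measurable_sum _ fun e _ => ?_
  have : Measurable fun ω : S × (ℕ → E → ℝ) => gaussianLLR (a e) (b e) (ω.2 s e) := by fun_prop
  exact this.indicator (hM.measurableSet_mem s e)

/-- Change of measure for functions of the observations of the first `n` rounds. -/
theorem IsAdaptive.lintegral_change (hM : IsAdaptive M) (ρ : Measure S) [IsProbabilityMeasure ρ]
    (a b : E → ℝ) (n : ℕ) (G : S × (ℕ → E → ℝ) → ℝ≥0∞) (hG : Measurable G)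
    (hobs : ∀ ω ω', ObsAgree M n ω ω' → G ω = G ω') :
    ∫⁻ ω, G ω ∂(rewardLaw ρ b) =
      ∫⁻ ω, G ω * ENNReal.ofReal (Real.exp (-obsLLR M a b n ω)) ∂(rewardLaw ρ a) := by
  induction n generalizing G with
  | zero =>
    simp only [obsLLR, Finset.range_zero, Finset.sum_empty, neg_zero, Real.exp_zero,
      ENNReal.ofReal_one, mul_one]
    have h : ∀ x : ℕ → E → ℝ, ∀ s, G (s, x) = G (s, 0) := fun x s =>
      hobs _ _ ⟨rfl, fun s hs => absurd hs (Nat.not_lt_zero s)⟩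
    unfold rewardLaw
    rw [lintegral_prod _ hG.aemeasurable, lintegral_prod _ hG.aemeasurable]
    simp [h]
  | succ n ih =>
    let ν : (E → ℝ) → Measure (E → ℝ) := fun a => Measure.pi fun e => gaussianReal (a e) 1
    have hmp := fun a : E → ℝ => measurePreserving_setRound ρ a n
    have hsec : Measurable fun p : (S × (ℕ → E → ℝ)) × (E → ℝ) => G (setRound n p.1 p.2) :=
      hG.comp (hmp a).measurable
    have hL := (hM.measurable_obsLLR a b (n + 1)).neg.exp.ennreal_ofReal
    have hGL := hG.mul hL
    have hsecL : Measurable fun p : (S × (ℕ → E → ℝ)) × (E → ℝ) => G (setRound n p.1 p.2) *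
        ENNReal.ofReal (Real.exp (-obsLLR M a b (n + 1) (setRound n p.1 p.2))) :=
      hGL.comp (hmp a).measurable
    calc ∫⁻ ω, G ω ∂(rewardLaw ρ b)
        = ∫⁻ p, G (setRound n p.1 p.2) ∂((rewardLaw ρ b).prod (ν b)) :=
          ((hmp b).lintegral_comp hG).symm
      _ = ∫⁻ ω, ∫⁻ y, G (setRound n ω y) ∂(ν b) ∂(rewardLaw ρ b) :=
          lintegral_prod _ hsec.aemeasurable
      _ = ∫⁻ ω, (∫⁻ y, G (setRound n ω y) ∂(ν b)) *
            ENNReal.ofReal (Real.exp (-obsLLR M a b n ω)) ∂(rewardLaw ρ a) := by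
          -- After averaging over round `n`, what remains is determined by the observations of the
          -- earlier rounds.
          refine ih _ hsec.lintegral_prod_right' fun ω ω' h => ?_
          refine lintegral_congr fun y => hobs _ _ ⟨h.1, fun s hs e he => ?_⟩
          rw [hM.eq_setRound (Nat.lt_succ_iff.1 hs)] at he
          rcases (Nat.lt_succ_iff.1 hs).lt_or_eq with hs' | rfl
          · simpa [setRound, Function.update_of_ne hs'.ne] using h.2 s hs' e he
          · simp [setRound]
      _ = ∫⁻ ω, ∫⁻ y, G (setRound n ω y) *
            ENNReal.ofReal (Real.exp (-obsLLR M a b (n + 1) (setRound n ω y)))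
            ∂(ν a) ∂(rewardLaw ρ a) := by
          refine lintegral_congr fun ω => ?_
          have hsω : Measurable fun y => G (setRound n ω y) :=
            hsec.comp measurable_prodMk_left
          -- With the past fixed, `G` sees round `n` only at the places `M n ω`, so only their
          -- densities appear.
          rw [lintegral_pi_gaussian_change a b (M n ω) _ hsω, ← lintegral_mul_const]
          · refine lintegral_congr fun y => ?_
            rw [hM.obsLLR_succ_setRound, neg_add, Real.exp_add, mul_assoc,
              ENNReal.ofReal_mul (Real.exp_nonneg _), ← Finset.sum_neg_distrib, Real.exp_sum,
              ENNReal.ofReal_prod_of_nonneg fun _ _ => Real.exp_nonneg _]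
            ring
          · exact hsω.mul (Finset.measurable_prod _ fun e _ => by fun_prop)
          · intro y z hyz
            refine hobs _ _ ⟨rfl, fun s hs e he => ?_⟩
            rw [hM.eq_setRound (Nat.lt_succ_iff.1 hs)] at he
            rcases (Nat.lt_succ_iff.1 hs).lt_or_eq with hs' | rfl
            · simp [setRound, Function.update_of_ne hs'.ne]
            · simpa [setRound] using hyz e he
      _ = ∫⁻ p, G (setRound n p.1 p.2) *
            ENNReal.ofReal (Real.exp (-obsLLR M a b (n + 1) (setRound n p.1 p.2)))
            ∂((rewardLaw ρ a).prod (ν a)) := (lintegral_prod _ hsecL.aemeasurable).symm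
      _ = _ := (hmp a).lintegral_comp hGL

lemma IsAdaptive.integrable_indicator_llr (hM : IsAdaptive M) (ρ : Measure S)
    [IsProbabilityMeasure ρ] (a b : E → ℝ) (s : ℕ) (e : E) :
    Integrable ({ω | e ∈ M s ω}.indicator fun ω => gaussianLLR (a e) (b e) (ω.2 s e))
      (rewardLaw ρ a) := by
  refine Integrable.indicator ?_ (hM.measurableSet_mem s e)
  have h : MeasurePreserving (fun ω : S × (ℕ → E → ℝ) => ω.2 s e) (rewardLaw ρ a)
      (gaussianReal (a e) 1) :=
    (measurePreserving_eval (fun e => gaussianReal (a e) 1) e).comp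
      ((measurePreserving_eval_infinitePi
        (fun _ : ℕ => Measure.pi fun e => gaussianReal (a e) 1) s).comp measurePreserving_snd)
  exact h.integrable_comp_of_integrable (integrable_gaussianLLR (a e) (b e))

lemma IsAdaptive.integral_indicator_llr (hM : IsAdaptive M) (ρ : Measure S)
    [IsProbabilityMeasure ρ] (a b : E → ℝ) (s : ℕ) (e : E) :
    ∫ ω, ({ω | e ∈ M s ω}.indicator fun ω => gaussianLLR (a e) (b e) (ω.2 s e)) ω
      ∂(rewardLaw ρ a) = (rewardLaw ρ a).real {ω | e ∈ M s ω} * ((a e - b e) ^ 2 / 2) := by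
  have hi := hM.integrable_indicator_llr ρ a b s e
  have hmp := measurePreserving_setRound ρ a s
  -- Whether `e` is observed in round `s` is decided before that round. Resampling the round
  -- replaces the log-likelihood ratio by its mean, the Gaussian relative entropy `(a e - b e)²/2`.
  conv_lhs => rw [← hmp.map_eq]
  rw [integral_map hmp.measurable.aemeasurable (by
    rw [hmp.map_eq]; exact hi.aestronglyMeasurable)]
  refine (integral_prod _ (hmp.integrable_comp_of_integrable hi)).trans ?_
  simp only [Function.comp_def]
  have : ∀ ω : S × (ℕ → E → ℝ), ∫ y, ({ω | e ∈ M s ω}.indicator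
      fun ω => gaussianLLR (a e) (b e) (ω.2 s e)) (setRound s ω y)
        ∂(Measure.pi fun e => gaussianReal (a e) 1) =
      {ω | e ∈ M s ω}.indicator (fun _ => (a e - b e) ^ 2 / 2) ω := by
    intro ω
    by_cases h : e ∈ M s ω
    · have h' : ∀ y, e ∈ M s (setRound s ω y) := fun y => by rwa [hM.eq_setRound le_rfl]
      simp only [Set.indicator, Set.mem_ofPred_eq, h', h, if_true]
      simp only [setRound, Function.update_self]
      have hev := measurePreserving_eval (fun e => gaussianReal (a e) 1) e
      rw [← integral_gaussianLLR, ← hev.map_eq,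
        integral_map hev.measurable.aemeasurable (by fun_prop)]
    · have h' : ∀ y, e ∉ M s (setRound s ω y) := fun y => by rwa [hM.eq_setRound le_rfl]
      simp [Set.indicator, h', h]
  simp_rw [this]
  rw [integral_indicator_const _ (hM.measurableSet_mem s e), smul_eq_mul]

lemma IsAdaptive.integrable_obsLLR (hM : IsAdaptive M) (ρ : Measure S)
    [IsProbabilityMeasure ρ] (a b : E → ℝ) (n : ℕ) :
    Integrable (obsLLR M a b n) (rewardLaw ρ a) := by
  refine integrable_finsetSum _ fun s _ => ?_
  simp_rw [sum_observed_eq]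
  exact integrable_finsetSum _ fun e _ => hM.integrable_indicator_llr ρ a b s e

lemma IsAdaptive.integral_obsLLR (hM : IsAdaptive M) (ρ : Measure S)
    [IsProbabilityMeasure ρ] (a b : E → ℝ) (n : ℕ) :
    ∫ ω, obsLLR M a b n ω ∂(rewardLaw ρ a) =
      ∑ s ∈ Finset.range n, ∑ e, (rewardLaw ρ a).real {ω | e ∈ M s ω} *
        ((a e - b e) ^ 2 / 2) := by
  unfold obsLLR
  simp_rw [sum_observed_eq]
  have hi : ∀ s e, Integrable (fun ω => {ω | e ∈ M s ω}.indicator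
      (fun _ => gaussianLLR (a e) (b e) (ω.2 s e)) ω) (rewardLaw ρ a) :=
    fun s e => hM.integrable_indicator_llr ρ a b s e
  rw [integral_finsetSum _ fun s _ => integrable_finsetSum _ fun e _ => hi s e]
  refine Finset.sum_congr rfl fun s _ => ?_
  rw [integral_finsetSum _ fun e _ => hi s e]
  exact Finset.sum_congr rfl fun e _ => hM.integral_indicator_llr ρ a b s e

/-- A form of the data-processing inequality: the expected log-likelihood ratio of the
observations bounds how differently an observable event can behave under the two laws. -/
theorem IsAdaptive.le_sum_divergence (hM : IsAdaptive M) (ρ : Measure S)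
    [IsProbabilityMeasure ρ] (a b : E → ℝ) (n : ℕ) (B : Set (S × (ℕ → E → ℝ)))
    (hB : MeasurableSet B) (hobs : ∀ ω ω', ObsAgree M n ω ω' → (ω ∈ B ↔ ω' ∈ B)) (x : ℝ) :
    -(x * (rewardLaw ρ a).real B) -
        Real.log (1 - (1 - Real.exp (-x)) * (rewardLaw ρ b).real B) ≤
      ∑ s ∈ Finset.range n, ∑ e, (rewardLaw ρ a).real {ω | e ∈ M s ω} *
        ((a e - b e) ^ 2 / 2) := by
  rw [← hM.integral_obsLLR ρ a b n]
  set P := rewardLaw ρ a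
  set Q := rewardLaw ρ b
  -- Donsker–Varadhan with the test function `-x · 1_B`: with `L` the log-likelihood ratio, Jensen
  -- under `P` and change of measure give `exp(E_P[g - L]) ≤ E_P[exp(g - L)] = E_Q[exp g]`.
  let g : S × (ℕ → E → ℝ) → ℝ := B.indicator fun _ => -x
  have hgm : Measurable g := measurable_const.indicator hB
  have hg : ∀ R : Measure (S × (ℕ → E → ℝ)), IsProbabilityMeasure R → Integrable g R :=
    fun R _ => (integrable_const _).indicator hB
  have hLi := hM.integrable_obsLLR ρ a b n
  have hLm := hM.measurable_obsLLR a b n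
  have hexpg : ∀ ω, Real.exp (g ω) = 1 - B.indicator (fun _ => 1 - Real.exp (-x)) ω := by
    intro ω
    by_cases h : ω ∈ B <;> simp [g, h]
  have hci : Integrable (B.indicator fun _ => 1 - Real.exp (-x)) Q :=
    (integrable_const _).indicator hB
  have hexpi : Integrable (fun ω => Real.exp (g ω)) Q := by
    simp_rw [hexpg]
    exact (integrable_const _).sub hci
  have hEQ : ∫ ω, Real.exp (g ω) ∂Q = 1 - (1 - Real.exp (-x)) * Q.real B := by
    simp_rw [hexpg]
    rw [integral_sub (integrable_const _) hci, integral_indicator_const _ hB]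
    simp [mul_comm]
  have hchange : ∫⁻ ω, ENNReal.ofReal (Real.exp (g ω)) ∂Q =
      ∫⁻ ω, ENNReal.ofReal (Real.exp (g ω - obsLLR M a b n ω)) ∂P := by
    rw [hM.lintegral_change ρ a b n _ hgm.exp.ennreal_ofReal]
    · refine lintegral_congr fun ω => ?_
      rw [← ENNReal.ofReal_mul (Real.exp_nonneg _), ← Real.exp_add, sub_eq_add_neg]
    · intro ω ω' h
      have := hobs ω ω' h
      by_cases hω : ω ∈ B
      · simp [g, hω, this.1 hω]
      · simp [g, hω, mt this.2 hω]
  have hQfin : ∫⁻ ω, ENNReal.ofReal (Real.exp (g ω)) ∂Q =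
      ENNReal.ofReal (∫ ω, Real.exp (g ω) ∂Q) :=
    (ofReal_integral_eq_lintegral_ofReal hexpi (ae_of_all _ fun _ => Real.exp_nonneg _)).symm
  have hexpPi : Integrable (fun ω => Real.exp (g ω - obsLLR M a b n ω)) P := by
    refine ⟨(hgm.sub hLm).exp.aestronglyMeasurable, ?_⟩
    rw [hasFiniteIntegral_iff_ofReal (ae_of_all _ fun _ => Real.exp_nonneg _), ← hchange, hQfin]
    exact ENNReal.ofReal_lt_top
  have hEP : ∫ ω, Real.exp (g ω - obsLLR M a b n ω) ∂P = ∫ ω, Real.exp (g ω) ∂Q := by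
    rw [integral_eq_lintegral_of_nonneg_ae (ae_of_all _ fun _ => Real.exp_nonneg _)
      hexpPi.aestronglyMeasurable, ← hchange, hQfin,
      ENNReal.toReal_ofReal (integral_nonneg fun _ => Real.exp_nonneg _)]
  have hJ : Real.exp (∫ ω, (g ω - obsLLR M a b n ω) ∂P) ≤
      ∫ ω, Real.exp (g ω - obsLLR M a b n ω) ∂P :=
    convexOn_exp.map_integral_le Real.continuous_exp.continuousOn isClosed_univ
      (ae_of_all _ fun _ => Set.mem_univ _) ((hg P inferInstance).sub hLi) hexpPi
  rw [hEP, hEQ] at hJ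
  have hlog := Real.log_le_log (Real.exp_pos _) hJ
  rw [Real.log_exp, integral_sub (hg P inferInstance) hLi, integral_indicator_const _ hB,
    smul_eq_mul] at hlog
  linarith [mul_neg (P.real B) x, mul_comm (P.real B) x]

end Adaptive

/-! ### The run of an algorithm as an adaptive observation. -/

instance {N : ℕ} : Fintype (MaxMatching N) := Fintype.ofFinite _

open Classical in
/-- The pairs of a matching. -/
def pairs {N : ℕ} (m : MaxMatching N) : Finset (Sym2 (Fin (2 * N))) :=
  Finset.univ.image fun i => s(i, m.1 i)

lemma mem_pairs {N : ℕ} (m : MaxMatching N) (i : Fin (2 * N)) : s(i, m.1 i) ∈ pairs m := by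
  classical
  exact Finset.mem_image_of_mem _ (Finset.mem_univ i)

/-- Summing over items counts each pair twice; the loss costs only a constant factor. -/
lemma sum_pairs_le {N : ℕ} (m : MaxMatching N) (f : Sym2 (Fin (2 * N)) → ℝ) (hf : ∀ e, 0 ≤ f e) :
    ∑ e ∈ pairs m, f e ≤ ∑ i, f s(i, m.1 i) := by
  classical
  exact Finset.sum_image_le_of_nonneg fun e _ => hf e

/-- Serves to write `E[τ]` as the sum of the probabilities that the algorithm is still running after
`s` rounds. -/
lemma enat_toENNReal_eq_tsum (x : ℕ∞) :
    (x : ℝ≥0∞) = ∑' s : ℕ, {s : ℕ | (s : ℕ∞) < x}.indicator (fun _ => (1 : ℝ≥0∞)) s := by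
  induction x with
  | top =>
    simp
  | coe n =>
    rw [tsum_eq_sum (s := Finset.range n) (by intro b hb; simpa using hb)]
    rw [Finset.sum_congr rfl (g := fun _ => (1 : ℝ≥0∞))
      (by intro b hb; simpa using Finset.mem_range.1 hb)]
    simp

namespace Algorithm

variable {N : ℕ} {S : Type*} [MeasurableSpace S] (A : Algorithm N S)

/-- The event that the algorithm has not stopped after `s` rounds. -/
def alive (s : ℕ) : Set (Outcome N S) := {ω | ∀ r ≤ s, (ω.1, A.hist ω r) ∉ A.halted r}

lemma mem_alive_iff_lt_tau (s : ℕ) (ω : Outcome N S) : ω ∈ A.alive s ↔ (s : ℕ∞) < A.tau ω := by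
  rw [← ENat.add_one_le_iff (ENat.natCast_ne_top s)]
  simp only [tau, le_iInf_iff, alive, Set.mem_ofPred_eq]
  refine forall_congr' fun r => ⟨fun h h' => ?_, fun h hr h' => ?_⟩
  · by_contra hlt
    exact h (by by_contra hr; exact hlt (by exact_mod_cast (not_le.1 hr))) h'
  · have : s + 1 ≤ r := by exact_mod_cast h h'
    omega

lemma tau_eq_iff (t : ℕ) (ω : Outcome N S) :
    A.tau ω = t ↔ (ω.1, A.hist ω t) ∈ A.halted t ∧
      ∀ r < t, (ω.1, A.hist ω r) ∉ A.halted r := by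
  constructor
  · intro h
    have h1 : ∀ r < t, (ω.1, A.hist ω r) ∉ A.halted r := fun r hr =>
      (A.mem_alive_iff_lt_tau r ω).2 (by rw [h]; exact_mod_cast hr) r le_rfl
    refine ⟨?_, h1⟩
    by_contra h2
    have : ω ∈ A.alive t := fun r hr => by
      rcases hr.lt_or_eq with hr | rfl
      · exact h1 r hr
      · exact h2
    rw [mem_alive_iff_lt_tau, h] at this
    exact lt_irrefl _ this
  · rintro ⟨h1, h2⟩
    refine le_antisymm (iInf₂_le t h1) (le_iInf₂ fun r hr => ?_)
    by_contra hlt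
    exact h2 r (by exact_mod_cast not_le.1 hlt) hr

lemma measurable_hist (t : ℕ) : Measurable fun ω : Outcome N S => A.hist ω t := by
  induction t with
  | zero => exact measurable_const
  | succ t ih =>
    have hs : Measurable fun ω : Outcome N S => A.sample t (ω.1, A.hist ω t) :=
      (A.measurable_sample t).comp (measurable_fst.prodMk ih)
    refine measurable_pi_lambda _ fun k => ?_
    refine Fin.lastCases ?_ (fun j => ?_) k
    · simp only [hist, Fin.snoc_last]
      refine measurable_pi_lambda _ fun i => ?_
      have h2 : Measurable fun p : Outcome N S × MaxMatching N => p.1.2 t s(i, p.2.1 i) :=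
        measurable_from_prod_countable_left fun m => by dsimp only; fun_prop
      exact h2.comp (measurable_id.prodMk hs)
    · simp only [hist, Fin.snoc_castSucc]
      fun_prop

lemma measurable_seed_hist (t : ℕ) : Measurable fun ω : Outcome N S => (ω.1, A.hist ω t) :=
  measurable_fst.prodMk (A.measurable_hist t)

lemma measurableSet_alive (s : ℕ) : MeasurableSet (A.alive s) := by
  have : A.alive s =
      ⋂ r ∈ Finset.range (s + 1), ((fun ω => (ω.1, A.hist ω r)) ⁻¹' A.halted r)ᶜ := by
    ext ω; simp [alive]
  rw [this]
  exact Finset.measurableSet_biInter _ fun r _ =>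
    (A.measurable_seed_hist r (A.measurableSet_halted r)).compl

/-- The event that round `s + 1` takes place and `m` is sampled in it. -/
def samples (s : ℕ) (m : MaxMatching N) : Set (Outcome N S) :=
  A.alive s ∩ {ω | A.sample s (ω.1, A.hist ω s) = m}

lemma measurableSet_samples (s : ℕ) (m : MaxMatching N) : MeasurableSet (A.samples s m) :=
  (A.measurableSet_alive s).inter
    (((A.measurable_sample s).comp (A.measurable_seed_hist s)) (measurableSet_singleton m))

open Classical in
/-- The pairs observed in round `s + 1`. -/
def observed (s : ℕ) (ω : Outcome N S) : Finset (Sym2 (Fin (2 * N))) :=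
  -- Nothing counts as observed after stopping; hence the divergence of any number of rounds is
  -- controlled by the expected counts.
  if ω ∈ A.alive s then pairs (A.sample s (ω.1, A.hist ω s)) else ∅

lemma mem_observed_iff (s : ℕ) (ω : Outcome N S) (e : Sym2 (Fin (2 * N))) :
    e ∈ A.observed s ω ↔ ∃ m, e ∈ pairs m ∧ ω ∈ A.samples s m := by
  by_cases h : ω ∈ A.alive s
  · simp [observed, samples, h]
  · simp [observed, samples, h]

/-- Before stopping, every entry of the history is an observed reward. Halting has to be excluded
because `hist` continues after it while `observed` is empty. -/
lemma hist_congr {n : ℕ} {ω ω' : Outcome N S} (h : ObsAgree A.observed n ω ω') {t : ℕ}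
    (htn : t ≤ n) (ht : ∀ r < t, (ω.1, A.hist ω r) ∉ A.halted r) : A.hist ω t = A.hist ω' t := by
  induction t with
  | zero => rfl
  | succ t ih =>
    have ih := ih (by omega) fun r hr => ht r (by omega)
    have hal : ω ∈ A.alive t := fun r hr => ht r (by omega)
    simp only [hist]
    rw [← ih, ← h.1]
    congr 1
    ext i
    refine h.2 t (by omega) _ ?_
    rw [mem_observed_iff]
    exact ⟨_, mem_pairs _ i, hal, rfl⟩

lemma tau_eq_congr {n : ℕ} {ω ω' : Outcome N S} (h : ObsAgree A.observed n ω ω') {t : ℕ}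
    (htn : t ≤ n) (ht : A.tau ω = t) : A.tau ω' = t := by
  rw [tau_eq_iff] at ht ⊢
  have hh : ∀ r ≤ t, A.hist ω r = A.hist ω' r := fun r hr =>
    A.hist_congr h (hr.trans htn) fun q hq => ht.2 q (hq.trans_le hr)
  rw [← h.1, ← hh t le_rfl]
  exact ⟨ht.1, fun r hr => by rw [← hh r hr.le]; exact ht.2 r hr⟩

lemma isAdaptive_observed : IsAdaptive A.observed where
  congr n ω ω' h := by
    by_cases hal : ω ∈ A.alive n
    · have hh : ∀ r ≤ n, A.hist ω r = A.hist ω' r := fun r hr =>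
        A.hist_congr h hr fun q hq => hal q (hq.le.trans hr)
      have hal' : ω' ∈ A.alive n := fun r hr => by
        rw [← h.1, ← hh r hr]; exact hal r hr
      simp only [observed, hal, hal', if_true]
      rw [← h.1, hh n le_rfl]
    · have hle : A.tau ω ≤ n := by rwa [mem_alive_iff_lt_tau, not_lt] at hal
      obtain ⟨t, ht⟩ := ENat.ne_top_iff_exists.1 (ne_top_of_le_ne_top (ENat.natCast_ne_top n) hle)
      rw [← ht] at hle
      have hal' : ω' ∉ A.alive n := by
        rw [mem_alive_iff_lt_tau, A.tau_eq_congr h (by exact_mod_cast hle) ht.symm, not_lt]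
        exact hle
      simp [observed, hal, hal']
  measurableSet_mem n e := by
    have : {ω | e ∈ A.observed n ω} = ⋃ m ∈ {m | e ∈ pairs m}, A.samples n m := by
      ext ω; simp [mem_observed_iff]
    rw [this]
    exact MeasurableSet.biUnion (Set.to_countable _) fun m _ => A.measurableSet_samples n m

/-- The event that the algorithm returns `m` after at most `n` rounds. -/
def returnsBy (m : MaxMatching N) (n : ℕ) : Set (Outcome N S) :=
  {ω | ∃ t ≤ n, A.tau ω = t ∧ A.output t (ω.1, A.hist ω t) = m}

lemma measurableSet_returnsBy (m : MaxMatching N) (n : ℕ) : MeasurableSet (A.returnsBy m n) := by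
  have : A.returnsBy m n = ⋃ t ∈ Finset.range (n + 1),
      (((fun ω => (ω.1, A.hist ω t)) ⁻¹' A.halted t ∩
        ⋂ r ∈ Finset.range t, ((fun ω => (ω.1, A.hist ω r)) ⁻¹' A.halted r)ᶜ) ∩
        {ω | A.output t (ω.1, A.hist ω t) = m}) := by
    ext ω
    simp only [returnsBy, tau_eq_iff, Set.mem_ofPred_eq, Set.mem_iUnion, Finset.mem_range,
      Nat.lt_succ_iff, Set.mem_inter_iff, Set.mem_preimage, Set.mem_iInter, Set.mem_compl_iff,
      exists_prop]
  rw [this]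
  refine Finset.measurableSet_biUnion _ fun t _ => MeasurableSet.inter (MeasurableSet.inter
    (A.measurable_seed_hist t (A.measurableSet_halted t))
    (Finset.measurableSet_biInter _ fun r _ =>
      (A.measurable_seed_hist r (A.measurableSet_halted r)).compl))
    (((A.measurable_output t).comp (A.measurable_seed_hist t)) (measurableSet_singleton m))

lemma returnsBy_congr (m : MaxMatching N) {n : ℕ} {ω ω' : Outcome N S}
    (h : ObsAgree A.observed n ω ω') : ω ∈ A.returnsBy m n ↔ ω' ∈ A.returnsBy m n := by
  have key : ∀ ω ω', ObsAgree A.observed n ω ω' → ω ∈ A.returnsBy m n → ω' ∈ A.returnsBy m n := by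
    rintro ω ω' h ⟨t, htn, ht, hout⟩
    refine ⟨t, htn, A.tau_eq_congr h htn ht, ?_⟩
    rw [← h.1, ← A.hist_congr h htn ((A.tau_eq_iff t ω).1 ht).2]
    exact hout
  -- `ObsAgree` uses the places observed along its first argument; adaptivity makes it symmetric.
  refine ⟨key ω ω' h, key ω' ω ⟨h.1.symm, fun s hs e he => (h.2 s hs e ?_).symm⟩⟩
  rwa [A.isAdaptive_observed.congr s ω ω' (h.mono hs.le)]

lemma returnsBy_mono (m : MaxMatching N) : Monotone (A.returnsBy m) :=
  fun _ _ h _ ⟨t, ht, h'⟩ => ⟨t, ht.trans h, h'⟩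

lemma iUnion_returnsBy (m : MaxMatching N) : ⋃ n, A.returnsBy m n = A.returns m := by
  ext ω
  simp only [Set.mem_iUnion, returnsBy, returns, Set.mem_ofPred_eq]
  exact ⟨fun ⟨n, t, _, h⟩ => ⟨t, h⟩, fun ⟨t, h⟩ => ⟨t, t, le_rfl, h⟩⟩

lemma measurableSet_returns (m : MaxMatching N) : MeasurableSet (A.returns m) := by
  rw [← iUnion_returnsBy]
  exact MeasurableSet.iUnion fun n => A.measurableSet_returnsBy m n

lemma disjoint_returns {m m' : MaxMatching N} (h : m ≠ m') :
    Disjoint (A.returns m) (A.returns m') := by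
  rw [Set.disjoint_left]
  rintro ω ⟨t, ht, hm⟩ ⟨t', ht', hm'⟩
  rw [ht] at ht'
  obtain rfl : t = t' := by exact_mod_cast ht'
  exact h (hm.symm.trans hm')

/-! ### Expected counts and the divergence they must supply. -/

variable (ρ : Measure S)

/-- The expected number of rounds in which `m` is sampled. -/
def expectedCount (u : Fin (2 * N) → ℝ) (m : MaxMatching N) : ℝ :=
  -- A divergent series would give the default value 0; the count is meaningful when `expectedTau`
  -- is finite.
  ∑' s, (outcomeLaw ρ u).real (A.samples s m)

lemma expectedCount_nonneg (u : Fin (2 * N) → ℝ) (m : MaxMatching N) :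
    0 ≤ A.expectedCount ρ u m := tsum_nonneg fun _ => measureReal_nonneg

lemma expectedTau_eq_tsum (u : Fin (2 * N) → ℝ) :
    A.expectedTau ρ u = ∑' s, outcomeLaw ρ u (A.alive s) := by
  unfold expectedTau
  simp_rw [enat_toENNReal_eq_tsum]
  have : ∀ ω s, {s : ℕ | (s : ℕ∞) < A.tau ω}.indicator (fun _ => (1 : ℝ≥0∞)) s =
      (A.alive s).indicator (fun _ => 1) ω := by
    intro ω s
    by_cases h : ω ∈ A.alive s
    · have h' : s ∈ {s : ℕ | (s : ℕ∞) < A.tau ω} := (A.mem_alive_iff_lt_tau s ω).1 h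
      rw [Set.indicator_of_mem h, Set.indicator_of_mem h']
    · have h' : s ∉ {s : ℕ | (s : ℕ∞) < A.tau ω} := mt (A.mem_alive_iff_lt_tau s ω).2 h
      rw [Set.indicator_of_notMem h, Set.indicator_of_notMem h']
  simp_rw [this]
  rw [lintegral_tsum fun s => (measurable_const.indicator (A.measurableSet_alive s)).aemeasurable]
  exact tsum_congr fun s => by simp [lintegral_indicator_const (A.measurableSet_alive s)]

lemma summable_real_alive {A : Algorithm N S} {ρ : Measure S} {u : Fin (2 * N) → ℝ} (hfin : A.expectedTau ρ u ≠ ⊤) :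
    Summable fun s => (outcomeLaw ρ u).real (A.alive s) := by
  rw [expectedTau_eq_tsum] at hfin
  exact ENNReal.summable_toReal hfin

variable [IsProbabilityMeasure ρ]

instance (u : Fin (2 * N) → ℝ) : IsProbabilityMeasure (outcomeLaw ρ u) :=
  inferInstanceAs (IsProbabilityMeasure (rewardLaw ρ (meanReward u)))

lemma sum_real_samples (u : Fin (2 * N) → ℝ) (s : ℕ) :
    ∑ m, (outcomeLaw ρ u).real (A.samples s m) = (outcomeLaw ρ u).real (A.alive s) := by
  rw [← measureReal_biUnion_finset]
  · congr 1
    ext ω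
    simp [samples]
  · intro m _ m' _ h
    simp only [Function.onFun, Set.disjoint_left]
    rintro ω ⟨_, h1⟩ ⟨_, h2⟩
    exact h (h1.symm.trans h2)
  · exact fun m _ => A.measurableSet_samples s m

variable {A ρ} {u : Fin (2 * N) → ℝ}

lemma summable_real_samples (hfin : A.expectedTau ρ u ≠ ⊤) (m : MaxMatching N) :
    Summable fun s => (outcomeLaw ρ u).real (A.samples s m) :=
  (summable_real_alive hfin).of_nonneg_of_le (fun _ => measureReal_nonneg) fun _ =>
    measureReal_mono Set.inter_subset_left

lemma sum_expectedCount (hfin : A.expectedTau ρ u ≠ ⊤) :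
    ∑ m, A.expectedCount ρ u m = (A.expectedTau ρ u).toReal := by
  unfold expectedCount
  rw [← Summable.tsum_finsetSum fun m _ => summable_real_samples hfin m, expectedTau_eq_tsum,
    ENNReal.tsum_toReal_eq fun s => measure_ne_top _ _]
  exact tsum_congr fun s => A.sum_real_samples ρ u s

lemma sum_divergence_le (hfin : A.expectedTau ρ u ≠ ⊤) (f : Sym2 (Fin (2 * N)) → ℝ)
    (hf : ∀ e, 0 ≤ f e) (n : ℕ) :
    ∑ s ∈ Finset.range n, ∑ e, (outcomeLaw ρ u).real {ω | e ∈ A.observed s ω} * f e ≤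
      ∑ m, A.expectedCount ρ u m * ∑ i, f s(i, m.1 i) := by
  classical
  have h1 : ∀ s, ∑ e, (outcomeLaw ρ u).real {ω | e ∈ A.observed s ω} * f e ≤
      ∑ m, (outcomeLaw ρ u).real (A.samples s m) * ∑ i, f s(i, m.1 i) := by
    intro s
    have h2 : ∀ e, (outcomeLaw ρ u).real {ω | e ∈ A.observed s ω} ≤
        ∑ m, if e ∈ pairs m then (outcomeLaw ρ u).real (A.samples s m) else 0 := by
      intro e
      rw [← Finset.sum_filter]
      have : {ω | e ∈ A.observed s ω} =
          ⋃ m ∈ Finset.univ.filter (fun m => e ∈ pairs m), A.samples s m := by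
        ext ω; simp [mem_observed_iff]
      rw [this]
      exact measureReal_biUnion_finset_le _ _
    calc _ ≤ ∑ e, (∑ m, if e ∈ pairs m then (outcomeLaw ρ u).real (A.samples s m) else 0) * f e :=
          Finset.sum_le_sum fun e _ => mul_le_mul_of_nonneg_right (h2 e) (hf e)
      _ = ∑ m, (outcomeLaw ρ u).real (A.samples s m) * ∑ e ∈ pairs m, f e := by
          simp_rw [Finset.sum_mul]
          rw [Finset.sum_comm]
          refine Finset.sum_congr rfl fun m _ => ?_
          simp [Finset.mul_sum, ite_mul, Finset.sum_ite_mem]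
      _ ≤ _ := Finset.sum_le_sum fun m _ =>
          mul_le_mul_of_nonneg_left (sum_pairs_le m f hf) measureReal_nonneg
  refine (Finset.sum_le_sum fun s _ => h1 s).trans ?_
  rw [Finset.sum_comm]
  refine Finset.sum_le_sum fun m _ => ?_
  rw [← Finset.sum_mul]
  exact mul_le_mul_of_nonneg_right ((summable_real_samples hfin m).sum_le_tsum _
    fun _ _ => measureReal_nonneg) (Finset.sum_nonneg fun i _ => hf _)

/-- If the matching `m` is returned with probability at most `1/2` under `u`, and with
probability at least `1 - δ` under `v`, then the observations must tell `u` from `v`. -/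
theorem divergence_lower_bound (hfin : A.expectedTau ρ u ≠ ⊤) {δ : ℝ} (hδ : 0 < δ)
    (hδ' : δ < 1 / 2) (v : Fin (2 * N) → ℝ) (m : MaxMatching N)
    (hu : (outcomeLaw ρ u).real (A.returns m) ≤ 1 / 2)
    (hv : 1 - δ ≤ (outcomeLaw ρ v).real (A.returns m)) :
    -Real.log (4 * δ * (1 - δ)) / 2 ≤ ∑ m, A.expectedCount ρ u m *
      ∑ i, (u i * u (m.1 i) - v i * v (m.1 i)) ^ 2 / 2 := by
  set R := ∑ m, A.expectedCount ρ u m * ∑ i, (u i * u (m.1 i) - v i * v (m.1 i)) ^ 2 / 2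
  -- The optimal exponent for probabilities `1/2` and `1 - δ`. The logarithm is then at most `log
  -- (2δ)`, and the bound becomes `-x/2 - log (2δ) = kl(1/2, δ)`.
  set x := Real.log ((1 - δ) / δ) with hx
  have hx0 : 0 ≤ x := Real.log_nonneg (by rw [le_div_iff₀ hδ]; linarith)
  have hex : Real.exp (-x) = δ / (1 - δ) := by
    rw [Real.exp_neg, hx, Real.exp_log (div_pos (by linarith) hδ), inv_div]
  have hc0 : 0 ≤ 1 - Real.exp (-x) := by
    have : Real.exp (-x) ≤ 1 := Real.exp_le_one_iff.2 (by linarith)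
    linarith
  have hpos : ∀ q : ℝ, q ≤ 1 → 0 < 1 - (1 - Real.exp (-x)) * q := by
    intro q hq
    have := Real.exp_pos (-x)
    nlinarith
  -- Data processing applies to events decided within `n` rounds; the limit `n → ∞` follows.
  have hn : ∀ n, -(x * (1 / 2)) -
      Real.log (1 - (1 - Real.exp (-x)) * (outcomeLaw ρ v).real (A.returnsBy m n)) ≤ R := by
    intro n
    have h1 := A.isAdaptive_observed.le_sum_divergence ρ (meanReward u) (meanReward v) n
      (A.returnsBy m n) (A.measurableSet_returnsBy m n) (fun _ _ h => A.returnsBy_congr m h) x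
    have h2 := sum_divergence_le hfin
      (fun e => (meanReward u e - meanReward v e) ^ 2 / 2) (fun e => by positivity) n
    have h3 : (outcomeLaw ρ u).real (A.returnsBy m n) ≤ 1 / 2 := by
      refine le_trans (measureReal_mono ?_) hu
      rw [← iUnion_returnsBy]
      exact Set.subset_iUnion _ n
    have h4 := mul_le_mul_of_nonneg_left h3 hx0
    refine le_trans ?_ (h1.trans h2)
    exact sub_le_sub_right (neg_le_neg h4) _
  have hlim : Filter.Tendsto (fun n => (outcomeLaw ρ v).real (A.returnsBy m n)) Filter.atTop
      (nhds ((outcomeLaw ρ v).real (A.returns m))) := by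
    rw [← iUnion_returnsBy]
    exact (ENNReal.tendsto_toReal (measure_ne_top _ _)).comp
      (tendsto_measure_iUnion_atTop (A.returnsBy_mono m))
  have hlim2 := ((hlim.const_mul (1 - Real.exp (-x))).const_sub 1).log
    (hpos _ measureReal_le_one).ne'
  have hR := le_of_tendsto (hlim2.const_sub (-(x * (1 / 2)))) (Filter.Eventually.of_forall hn)
  have hlog : Real.log (1 - (1 - Real.exp (-x)) * (outcomeLaw ρ v).real (A.returns m)) ≤
      Real.log (2 * δ) := by
    refine Real.log_le_log (hpos _ measureReal_le_one) ?_
    have h5 := mul_le_mul_of_nonneg_left hv hc0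
    have h6 : (1 - Real.exp (-x)) * (1 - δ) = 1 - 2 * δ := by
      rw [hex]
      have : 1 - δ ≠ 0 := by linarith
      field_simp
      ring
    linarith
  have hxl : x = Real.log (1 - δ) - Real.log δ :=
    Real.log_div (by linarith) hδ.ne'
  rw [Real.log_mul (by norm_num) hδ.ne'] at hlog
  rw [Real.log_mul (by positivity) (by linarith), Real.log_mul (by norm_num) hδ.ne']
  have h4 : Real.log 4 = 2 * Real.log 2 := by
    rw [show (4 : ℝ) = 2 ^ 2 by norm_num, Real.log_pow]; norm_num
  linarith

end Algorithm

/-! ### Optimal matchings of sorted vectors, and nearby vectors with another optimum. -/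

section Matchings

variable {N : ℕ}

/-- The matching `{1, 2}, {3, 4}, …`. -/
def standardMatching (N : ℕ) : MaxMatching N :=
  ⟨fun k => if h : (k : ℕ) % 2 = 0 then ⟨k + 1, by omega⟩ else ⟨k - 1, by omega⟩, by
    refine ⟨fun k => ?_, fun k => ?_⟩
    · rcases Nat.mod_two_eq_zero_or_one k with h | h
      · have h' : ((k : ℕ) + 1) % 2 ≠ 0 := by omega
        simp [h, h']
      · have h' : ((k : ℕ) - 1) % 2 = 0 := by omega
        have h'' : (k : ℕ) - 1 + 1 = k := by omega
        simp [h, h', h'']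
    · rcases Nat.mod_two_eq_zero_or_one k with h | h
      · simp [h, Fin.ext_iff]
      · simp [h, Fin.ext_iff]; omega⟩

lemma standardMatching_val (k : Fin (2 * N)) :
    (((standardMatching N).1 k : Fin (2 * N)) : ℕ) =
      if (k : ℕ) % 2 = 0 then (k : ℕ) + 1 else k - 1 := by
  unfold standardMatching
  dsimp only
  split_ifs <;> rfl

/-- The matching obtained by renaming the items. -/
def relabel (σ : Equiv.Perm (Fin (2 * N))) (m : MaxMatching N) : MaxMatching N :=
  ⟨fun i => σ (m.1 (σ.symm i)), fun i => by simp [m.2.1 _], fun i h =>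
    m.2.2 (σ.symm i) (σ.injective (by simpa using h))⟩

lemma relabel_relabel_symm (σ : Equiv.Perm (Fin (2 * N))) (m : MaxMatching N) :
    relabel σ (relabel σ.symm m) = m := by
  apply Subtype.ext; funext i; simp [relabel]

lemma matchingReward_relabel (u : Fin (2 * N) → ℝ) (σ : Equiv.Perm (Fin (2 * N)))
    (m : MaxMatching N) : matchingReward u (relabel σ m) = matchingReward (u ∘ σ) m := by
  unfold matchingReward
  rw [← Equiv.sum_comp σ]
  simp [relabel]

lemma relabel_standardMatching_ne {σ : Equiv.Perm (Fin (2 * N))} (i : Fin (2 * N))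
    (h : σ ((standardMatching N).1 i) ≠ (standardMatching N).1 (σ i)) :
    relabel σ (standardMatching N) ≠ standardMatching N := by
  intro h'
  apply h
  conv_rhs => rw [← h']
  simp [relabel]

/-- Uncrossing two pairs improves a matching that differs from the standard one. -/
lemma exists_matchingReward_lt {w : Fin (2 * N) → ℝ} (hw : StrictAnti w) {m : MaxMatching N}
    (hm : m ≠ standardMatching N) : ∃ m', matchingReward w m < matchingReward w m' := by
  classical
  have hne : (Finset.univ.filter fun i => m.1 i ≠ (standardMatching N).1 i).Nonempty := by
    by_contra h
    rw [Finset.not_nonempty_iff_eq_empty, Finset.filter_eq_empty_iff] at h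
    exact hm (Subtype.ext (funext fun i => not_not.1 (h (Finset.mem_univ i))))
  obtain ⟨i, hi, hmin⟩ := Finset.exists_minimal hne
  have hi : m.1 i ≠ (standardMatching N).1 i := (Finset.mem_filter.1 hi).2
  have hmin : ∀ k < i, m.1 k = (standardMatching N).1 k := by
    intro k hk
    by_contra hk'
    exact absurd (hmin (Finset.mem_filter.2 ⟨Finset.mem_univ k, hk'⟩) hk.le) (not_le.2 hk)
  have hinv := m.2.1
  have hinv' := (standardMatching N).2.1
  obtain ⟨b, hb⟩ : ∃ b, b = (standardMatching N).1 i := ⟨_, rfl⟩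
  obtain ⟨j, hj⟩ : ∃ j, j = m.1 i := ⟨_, rfl⟩
  obtain ⟨l, hl⟩ : ∃ l, l = m.1 b := ⟨_, rfl⟩
  have hmj : m.1 j = i := by rw [hj, hinv]
  have hml : m.1 l = b := by rw [hl, hinv]
  have hsb : (standardMatching N).1 b = i := by rw [hb, hinv']
  have hjb : j ≠ b := by rw [hj, hb]; exact hi
  have hji : j ≠ i := by rw [hj]; exact m.2.2 i
  have hlb : l ≠ b := by rw [hl]; exact m.2.2 b
  have hli : l ≠ i := fun h => hjb (by rw [hj, ← h, hml])
  have hbi : b ≠ i := by rw [hb]; exact (standardMatching N).2.2 i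
  have hlj : l ≠ j := fun h => hbi (by rw [← hml, h, hmj])
  have hib : i < b := by
    by_contra h
    have h := hmin b (lt_of_le_of_ne (not_lt.1 h) hbi)
    exact hli (by rw [hl, h, hsb])
  have hij : i < j := by
    by_contra h
    have h := hmin j (lt_of_le_of_ne (not_lt.1 h) hji)
    rw [hmj] at h
    exact hjb (by rw [hb, h, hinv'])
  have hil : i < l := by
    by_contra h
    have h := hmin l (lt_of_le_of_ne (not_lt.1 h) hli)
    rw [hml] at h
    exact hli (by rw [← hsb, h, hinv'])
  have hbv : (b : ℕ) = i + 1 := by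
    have h1 := standardMatching_val i
    rw [← hb] at h1
    have h2 : (i : ℕ) < b := hib
    split_ifs at h1 <;> omega
  have hbj : b < j := by
    refine lt_of_le_of_ne ?_ hjb.symm
    have : (i : ℕ) < j := hij
    rw [Fin.le_def]; omega
  -- As `i` is the first item with a wrong partner, `i < l` and `b = i + 1 < j`. Replacing `{i,j},
  -- {b,l}` by `{i,b}, {j,l}` gains `(w i - w l)(w b - w j) > 0`.
  refine ⟨relabel (Equiv.swap j b) m, ?_⟩
  rw [matchingReward_relabel, ← sub_pos]
  unfold matchingReward
  rw [← sub_div, ← Finset.sum_sub_distrib]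
  have hsupp : ∀ x ∉ ({i, b, j, l} : Finset (Fin (2 * N))),
      (w ∘ Equiv.swap j b) x * (w ∘ Equiv.swap j b) (m.1 x) - w x * w (m.1 x) = 0 := by
    intro x hx
    simp only [Finset.mem_insert, Finset.mem_singleton, not_or] at hx
    have h1 : m.1 x ≠ j := fun h => hx.1 (by rw [← hmj, ← h, hinv])
    have h2 : m.1 x ≠ b := fun h => hx.2.2.2 (by rw [hl, ← h, hinv])
    simp [Equiv.swap_apply_of_ne_of_ne hx.2.2.1 hx.2.1, Equiv.swap_apply_of_ne_of_ne h1 h2]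
  rw [← Finset.sum_subset (Finset.subset_univ {i, b, j, l}) fun x _ hx => hsupp x hx]
  rw [Finset.sum_insert (by simp [hbi.symm, hji.symm, hli.symm]),
    Finset.sum_insert (by simp [hjb.symm, hlb.symm]), Finset.sum_insert (by simp [hlj.symm]),
    Finset.sum_singleton, hmj, hml, ← hj, ← hl]
  simp only [Function.comp_apply, Equiv.swap_apply_left, Equiv.swap_apply_right,
    Equiv.swap_apply_of_ne_of_ne hji.symm hbi.symm, Equiv.swap_apply_of_ne_of_ne hlj hlb]
  have h1 := mul_pos (sub_pos.2 (hw hil)) (sub_pos.2 (hw hbj))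
  nlinarith

/-- A maximizer exists by finiteness, and every nonstandard matching can be strictly improved. -/
lemma isUniqueOptimal_standardMatching {w : Fin (2 * N) → ℝ} (hw : StrictAnti w) :
    IsUniqueOptimal w (standardMatching N) := by
  obtain ⟨m₀, -, hmax⟩ := Finset.exists_max_image Finset.univ (matchingReward w)
    ⟨standardMatching N, Finset.mem_univ _⟩
  have h0 : m₀ = standardMatching N := by
    by_contra h
    obtain ⟨m', hm'⟩ := exists_matchingReward_lt hw h
    exact absurd (hmax m' (Finset.mem_univ _)) (not_le.2 hm')
  intro m hm
  obtain ⟨m', hm'⟩ := exists_matchingReward_lt hw hm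
  rw [← h0]
  exact hm'.trans_le (hmax m' (Finset.mem_univ _))

/-- If the items are sorted by `σ`, then matching neighbours is optimal. -/
lemma isUniqueOptimal_relabel {v : Fin (2 * N) → ℝ} {σ : Equiv.Perm (Fin (2 * N))}
    (h : StrictAnti (v ∘ σ)) : IsUniqueOptimal v (relabel σ (standardMatching N)) := by
  intro m hm
  obtain ⟨m', rfl⟩ : ∃ m', m = relabel σ m' := ⟨_, (relabel_relabel_symm σ m).symm⟩
  rw [matchingReward_relabel, matchingReward_relabel]
  exact isUniqueOptimal_standardMatching h _ fun h' => hm (by rw [h'])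

/-- A vector sorted by `σ`, moved towards one that is strictly sorted by `σ`. -/
def strictify (v : Fin (2 * N) → ℝ) (σ : Equiv.Perm (Fin (2 * N))) (ε : ℝ) (i : Fin (2 * N)) : ℝ :=
  -- The values `1/(rank + 2)`, with ranks from 0, lie in `(0,1)` and decrease strictly along `σ`.
  (1 - ε) * v i + ε * (1 / ((σ.symm i : ℕ) + 2 : ℝ))

lemma strictAnti_strictify {v : Fin (2 * N) → ℝ} {σ : Equiv.Perm (Fin (2 * N))}
    (hv : Antitone (v ∘ σ)) {ε : ℝ} (hε : ε ∈ Set.Ioo (0 : ℝ) 1) :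
    StrictAnti (strictify v σ ε ∘ σ) := by
  intro i j hij
  have h1 : v (σ j) ≤ v (σ i) := hv hij.le
  have h2 : (1 : ℝ) / ((j : ℕ) + 2) < 1 / ((i : ℕ) + 2) := by
    have : ((i : ℕ) : ℝ) < (j : ℕ) := by exact_mod_cast hij
    exact one_div_lt_one_div_of_lt (by positivity) (by linarith)
  simp only [Function.comp_apply, strictify, Equiv.symm_apply_apply]
  exact add_lt_add_of_le_of_lt (mul_le_mul_of_nonneg_left h1 (by linarith [hε.2]))
    (mul_lt_mul_of_pos_left h2 hε.1)

lemma strictify_mem_Ioo {v : Fin (2 * N) → ℝ} (σ : Equiv.Perm (Fin (2 * N)))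
    (hv : ∀ i, v i ∈ Set.Ioo (0 : ℝ) 1) {ε : ℝ} (hε : ε ∈ Set.Ioo (0 : ℝ) 1) (i : Fin (2 * N)) :
    strictify v σ ε i ∈ Set.Ioo (0 : ℝ) 1 := by
  have h := convex_Ioo (0 : ℝ) 1 (hv i)
    (y := 1 / ((σ.symm i : ℕ) + 2 : ℝ)) ⟨by positivity, ?_⟩
    (sub_nonneg.2 hε.2.le) hε.1.le (by ring)
  · simpa [strictify] using h
  · rw [div_lt_one (by positivity)]
    have : (0 : ℝ) ≤ (σ.symm i : ℕ) := Nat.cast_nonneg _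
    linarith

/-- Lowering or raising the item `a` by its gap makes it cross an item of another pair. -/
lemma exists_crossing (hN : 2 ≤ N) {u : Fin (2 * N) → ℝ} (hu : Antitone u) (a : Fin (2 * N)) :
    ∃ b, (u a - u b) ^ 2 = gap u (a + 1) ^ 2 ∧ ∃ σ : Equiv.Perm (Fin (2 * N)),
      Antitone (Function.update u a (u b) ∘ σ) ∧
        relabel σ (standardMatching N) ≠ standardMatching N := by
  -- The modified vector is `u` composed with a map of indices, so sortedness becomes a statement
  -- about indices alone.
  have key : ∀ (b : Fin (2 * N)) (σ : Equiv.Perm (Fin (2 * N))),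
      Monotone (Function.update id a b ∘ σ) → Antitone (Function.update u a (u b) ∘ σ) := by
    intro b σ h
    have : Function.update u a (u b) = u ∘ Function.update id a b := by
      funext i; by_cases hi : i = a <;> simp [hi]
    rw [this, Function.comp_assoc]
    exact hu.comp_monotone h
  obtain ⟨k, hk⟩ := a
  by_cases h0 : k = 0
  · subst h0
    -- Item 1, lowered to `u_3`, can be placed third: the order 2, 3, 1 pairs items 2 and 3.
    refine ⟨⟨2, by omega⟩, ?_, Equiv.swap ⟨0, by omega⟩ ⟨1, by omega⟩ *
      Equiv.swap ⟨1, by omega⟩ ⟨2, by omega⟩, key _ _ ?_,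
      relabel_standardMatching_ne ⟨0, by omega⟩ ?_⟩
    · have h3 : 3 ≤ 2 * N := by omega
      have h1 : 1 ≤ 2 * N := by omega
      simp [gap, param, h3, h1]
    · intro i j hij
      simp only [Function.comp_apply, Equiv.Perm.mul_apply, Equiv.swap_apply_def,
        Function.update_apply, id, Fin.ext_iff, Fin.le_def] at hij ⊢
      grind
    · simp only [ne_eq, Fin.ext_iff, Equiv.Perm.mul_apply, Equiv.swap_apply_def,
        standardMatching_val]
      grind
  by_cases hl : k + 1 = 2 * N
  -- The mirror image: the last item, raised to the value of item `2N-2`, is placed just before it.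
  · refine ⟨⟨k - 2, by omega⟩, ?_, Equiv.swap ⟨k - 1, by omega⟩ ⟨k, by omega⟩ *
      Equiv.swap ⟨k - 2, by omega⟩ ⟨k - 1, by omega⟩, key _ _ ?_,
      relabel_standardMatching_ne ⟨k - 2, by omega⟩ ?_⟩
    · have h1 : 1 ≤ 2 * N - 2 ∧ 2 * N - 2 ≤ 2 * N := by omega
      have h2 : 1 ≤ 2 * N := by omega
      have h3 : 2 * N ≠ 1 := by omega
      have h4 : 2 * N - 2 - 1 = k - 2 := by omega
      have h5 : 2 * N - 1 = k := by omega
      simp only [gap, param, h3, hl, if_false, if_true, h1, h2, h4, h5, le_refl, and_self,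
        dite_true]
      ring
    · intro i j hij
      simp only [Function.comp_apply, Equiv.Perm.mul_apply, Equiv.swap_apply_def,
        Function.update_apply, id, Fin.ext_iff, Fin.le_def] at hij ⊢
      grind
    · have hs : (standardMatching N).1 ⟨k - 2, by omega⟩ = ⟨k - 3, by omega⟩ := by
        rw [Fin.ext_iff, standardMatching_val]
        grind
      rw [hs]
      simp only [ne_eq, Fin.ext_iff, Equiv.Perm.mul_apply, Equiv.swap_apply_def,
        standardMatching_val]
      grind
  rcases Nat.even_or_odd k with he | ho
  -- An inner item now ties with its neighbour in the adjacent pair, and the two may be exchanged.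
  -- Indices start at 0, so even `k` is an odd item.
  · refine ⟨⟨k - 1, by omega⟩, ?_, Equiv.swap ⟨k - 1, by omega⟩ ⟨k, by omega⟩, key _ _ ?_,
      relabel_standardMatching_ne ⟨k - 2, by omega⟩ ?_⟩
    · have h1 : 1 ≤ k ∧ k ≤ 2 * N := by omega
      have h2 : 1 ≤ k + 1 ∧ k + 1 ≤ 2 * N := by omega
      have h3 : ¬ Even (k + 1) := by simpa [Nat.even_add_one] using he
      have h4 : k + 1 ≠ 1 := by omega
      simp only [gap, param, hl, if_false, h1, h2, h3, h4, and_self, dite_true,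
        Nat.add_sub_cancel]
      ring
    · intro i j hij
      simp only [Function.comp_apply, Equiv.swap_apply_def,
        Function.update_apply, id, Fin.ext_iff, Fin.le_def] at hij ⊢
      grind
    · simp only [ne_eq, Fin.ext_iff, Equiv.swap_apply_def, standardMatching_val]
      grind
  · refine ⟨⟨k + 1, by omega⟩, ?_, Equiv.swap ⟨k, by omega⟩ ⟨k + 1, by omega⟩, key _ _ ?_,
      relabel_standardMatching_ne ⟨k - 1, by omega⟩ ?_⟩
    · have h1 : 1 ≤ k + 1 + 1 ∧ k + 1 + 1 ≤ 2 * N := by omega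
      have h2 : 1 ≤ k + 1 ∧ k + 1 ≤ 2 * N := by omega
      have h3 : Even (k + 1) := ho.add_one
      have h4 : k + 1 ≠ 1 := by omega
      simp only [gap, param, hl, if_false, h1, h2, h3, h4, and_self, dite_true, if_true,
        Nat.add_sub_cancel]
    · intro i j hij
      simp only [Function.comp_apply, Equiv.swap_apply_def,
        Function.update_apply, id, Fin.ext_iff, Fin.le_def] at hij ⊢
      grind
    · simp only [ne_eq, Fin.ext_iff, Equiv.swap_apply_def, standardMatching_val]
      grind

end Matchings

/-! ### The size of `kl(1/2, δ)`. -/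

lemma neg_log_pos_of_lt_half {δ : ℝ} (hδ : 0 < δ) (hδ' : δ < 1 / 2) :
    0 < -Real.log (4 * δ * (1 - δ)) := by
  rw [neg_pos]
  exact Real.log_neg (mul_pos (by linarith) (by linarith)) (by
    have : 0 < (1 / 2 - δ) ^ 2 := pow_pos (by linarith) 2
    nlinarith)

/-- The binary relative entropy `kl(1/2, δ)` is at least of order `log (1/δ)`. -/
lemma exists_mul_log_le (δ₀ : ℝ) (hδ₀ : δ₀ ∈ Set.Ioo (0 : ℝ) (1 / 2)) :
    ∃ c : ℝ, 0 < c ∧ ∀ δ : ℝ, 0 < δ → δ ≤ δ₀ →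
      c * Real.log (1 / δ) ≤ -Real.log (4 * δ * (1 - δ)) / 2 := by
  have h0 := neg_log_pos_of_lt_half hδ₀.1 hδ₀.2
  have h16 : 0 < Real.log 16 := Real.log_pos (by norm_num)
  -- For `δ ≤ 1/16`, `log 4 ≤ log(1/δ)/2`, which leaves a quarter of `log(1/δ)`. For larger `δ`,
  -- `log(1/δ) ≤ log 16` and `kl(1/2, ·)` is decreasing up to `δ₀`.
  refine ⟨min (1 / 4) (-Real.log (4 * δ₀ * (1 - δ₀)) / 2 / Real.log 16), by positivity,
    fun δ hδ hδ' => ?_⟩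
  have hlog : 0 ≤ Real.log (1 / δ) :=
    Real.log_nonneg (by rw [le_div_iff₀ hδ]; linarith [hδ₀.2])
  rw [one_div δ, Real.log_inv] at hlog ⊢
  rcases le_or_gt δ (1 / 16) with h | h
  · refine (mul_le_mul_of_nonneg_right (min_le_left _ _) hlog).trans ?_
    have h1 : Real.log (4 * δ * (1 - δ)) ≤ Real.log (4 * δ) :=
      Real.log_le_log (mul_pos (by linarith) (by linarith)) (by nlinarith)
    have h2 : Real.log δ ≤ Real.log (1 / 16) := Real.log_le_log hδ h
    rw [Real.log_mul (by norm_num) hδ.ne'] at h1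
    rw [one_div, Real.log_inv] at h2
    have h3 : Real.log 16 = 2 * Real.log 4 := by
      rw [show (16 : ℝ) = 4 ^ 2 by norm_num, Real.log_pow]; norm_num
    linarith
  · refine (mul_le_mul_of_nonneg_right (min_le_right _ _) hlog).trans ?_
    have h1 : -Real.log δ ≤ Real.log 16 := by
      rw [← Real.log_inv]
      exact Real.log_le_log (by positivity) (by
        rw [inv_le_comm₀ hδ (by norm_num)]; linarith)
    have h2 : Real.log (4 * δ * (1 - δ)) ≤ Real.log (4 * δ₀ * (1 - δ₀)) :=
      Real.log_le_log (mul_pos (by linarith) (by linarith [hδ₀.2])) (by nlinarith [hδ₀.2])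
    calc _ ≤ -Real.log (4 * δ₀ * (1 - δ₀)) / 2 / Real.log 16 * Real.log 16 :=
          mul_le_mul_of_nonneg_left h1 (by positivity)
      _ = -Real.log (4 * δ₀ * (1 - δ₀)) / 2 := div_mul_cancel₀ _ h16.ne'
      _ ≤ _ := by linarith

/-! ### The lower bounds. -/

namespace Algorithm

variable {N : ℕ} {S : Type*} [MeasurableSpace S] {A : Algorithm N S} {ρ : Measure S}
  [IsProbabilityMeasure ρ] {u : Fin (2 * N) → ℝ} {δ : ℝ}

/-- The PAC property says nothing at a `v` with ties. It applies to the strictly sorted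
perturbations `strictify v σ ε`, and the right-hand side is continuous in `ε` because the counts are
taken under `u`. -/
lemma divergence_lower_bound_of_sorted (hfin : A.expectedTau ρ u ≠ ⊤) (hδ : 0 < δ)
    (hδ' : δ < 1 / 2) (hA : A.IsDeltaPAC ρ δ) {v : Fin (2 * N) → ℝ}
    (hv : ∀ i, v i ∈ Set.Ioo (0 : ℝ) 1) {σ : Equiv.Perm (Fin (2 * N))} (hσ : Antitone (v ∘ σ))
    (hu : (outcomeLaw ρ u).real (A.returns (relabel σ (standardMatching N))) ≤ 1 / 2) :
    -Real.log (4 * δ * (1 - δ)) / 2 ≤ ∑ m, A.expectedCount ρ u m *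
      ∑ i, (u i * u (m.1 i) - v i * v (m.1 i)) ^ 2 / 2 := by
  let F : ℝ → ℝ := fun ε => ∑ m, A.expectedCount ρ u m *
    ∑ i, (u i * u (m.1 i) - strictify v σ ε i * strictify v σ ε (m.1 i)) ^ 2 / 2
  have hF : Continuous F := by
    unfold F strictify; fun_prop
  have hF0 : F 0 = ∑ m, A.expectedCount ρ u m *
      ∑ i, (u i * u (m.1 i) - v i * v (m.1 i)) ^ 2 / 2 := by
    simp [F, strictify]
  rw [← hF0]
  refine ge_of_tendsto (hF.continuousWithinAt (s := Set.Ioi 0) (x := 0)) ?_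
  filter_upwards [Ioo_mem_nhdsGT (show (0 : ℝ) < 1 by norm_num)] with ε hε
  refine divergence_lower_bound hfin hδ hδ' _ _ hu ?_
  have h := hA _ (strictify_mem_Ioo σ hv hε) _ (isUniqueOptimal_relabel (strictAnti_strictify hσ hε))
  exact (ENNReal.ofReal_le_iff_le_toReal (measure_ne_top _ _)).1 h

/-- The observations must tell `u` from every vector with another optimal matching. -/
theorem divergence_lower_bound_of_ne (hfin : A.expectedTau ρ u ≠ ⊤) (hδ : 0 < δ)
    (hδ' : δ < 1 / 2) (hA : A.IsDeltaPAC ρ δ) (hu : ∀ i, u i ∈ Set.Ioo (0 : ℝ) 1)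
    (hanti : Antitone u) {v : Fin (2 * N) → ℝ}
    (hv : ∀ i, v i ∈ Set.Ioo (0 : ℝ) 1) {σ : Equiv.Perm (Fin (2 * N))} (hσ : Antitone (v ∘ σ))
    (hne : relabel σ (standardMatching N) ≠ standardMatching N) :
    -Real.log (4 * δ * (1 - δ)) / 2 ≤ ∑ m, A.expectedCount ρ u m *
      ∑ i, (u i * u (m.1 i) - v i * v (m.1 i)) ^ 2 / 2 := by
  refine divergence_lower_bound_of_sorted hfin hδ hδ' hA hv hσ ?_
  -- `u` itself may have ties, so its optimum need not be unique. If the standard matching had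
  -- probability at most 1/2, taking `v = u` would give a positive lower bound for zero divergence.
  have h1 : 1 / 2 < (outcomeLaw ρ u).real (A.returns (standardMatching N)) := by
    by_contra h
    have h2 := divergence_lower_bound_of_sorted hfin hδ hδ' hA hu (σ := 1) hanti (not_lt.1 h)
    simp only [sub_self, ne_eq, OfNat.ofNat_ne_zero, not_false_eq_true, zero_pow, zero_div,
      Finset.sum_const_zero, mul_zero] at h2
    linarith [neg_log_pos_of_lt_half hδ hδ']
  have h3 := measureReal_union (μ := outcomeLaw ρ u) (A.disjoint_returns hne)
    (A.measurableSet_returns (standardMatching N))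
  have h4 : (outcomeLaw ρ u).real (A.returns (relabel σ (standardMatching N)) ∪
    A.returns (standardMatching N)) ≤ 1 := measureReal_le_one
  linarith

/-- The item `a` has to be observed often enough to tell its parameter from one that is shifted
by the gap of `a`. -/
theorem item_lower_bound (hN : 2 ≤ N) (hfin : A.expectedTau ρ u ≠ ⊤) (hδ : 0 < δ)
    (hδ' : δ < 1 / 2) (hA : A.IsDeltaPAC ρ δ) (hu : ∀ i, u i ∈ Set.Ioo (0 : ℝ) 1)
    (hanti : Antitone u) (a : Fin (2 * N)) :
    -Real.log (4 * δ * (1 - δ)) / 2 ≤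
      (∑ m, A.expectedCount ρ u m * u (m.1 a) ^ 2) * gap u (a + 1) ^ 2 := by
  classical
  obtain ⟨b, hb, σ, hσ, hne⟩ := exists_crossing hN hanti a
  have hv : ∀ i, Function.update u a (u b) i ∈ Set.Ioo (0 : ℝ) 1 := by
    intro i
    by_cases hi : i = a
    · subst hi; simpa using hu b
    · simpa [Function.update_of_ne hi] using hu i
  refine (divergence_lower_bound_of_ne hfin hδ hδ' hA hu hanti hv hσ hne).trans_eq ?_
  rw [Finset.sum_mul, ← hb]
  refine Finset.sum_congr rfl fun m _ => ?_
  rw [mul_assoc]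
  congr 1
  have hma : m.1 a ≠ a := m.2.2 a
  have hmm : m.1 (m.1 a) = a := m.2.1 a
  -- Only the pair `{a, m a}` changes its mean; being counted from both ends cancels the factor
  -- `1/2`.
  rw [← Finset.sum_subset (Finset.subset_univ {a, m.1 a}), Finset.sum_pair hma.symm, hmm]
  · simp only [Function.update_self, Function.update_of_ne hma]
    ring
  · intro i _ hi
    simp only [Finset.mem_insert, Finset.mem_singleton, not_or] at hi
    have : m.1 i ≠ a := fun h => hi.2 (by rw [← h, m.2.1 i])
    simp [Function.update_of_ne hi.1, Function.update_of_ne this]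

/-- The bound that adds up the contributions of all items. -/
theorem sum_gap_lower_bound (hN : 2 ≤ N) (hfin : A.expectedTau ρ u ≠ ⊤) (hδ : 0 < δ)
    (hδ' : δ < 1 / 2) (hA : A.IsDeltaPAC ρ δ) (hu : ∀ i, u i ∈ Set.Ioo (0 : ℝ) 1)
    (hanti : Antitone u) :
    (∑ i ∈ (Finset.Icc 1 (2 * N)).filter (fun i => 0 < gap u i),
      1 / (∑ j, u j ^ 2) * (1 / gap u i ^ 2)) * (-Real.log (4 * δ * (1 - δ)) / 2) ≤
        (A.expectedTau ρ u).toReal := by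
  set κ := -Real.log (4 * δ * (1 - δ)) / 2
  set Q := ∑ j, u j ^ 2
  have hQ : 0 < Q := Finset.sum_pos (fun i _ => pow_pos (hu i).1 2) ⟨⟨0, by omega⟩, by simp⟩
  have hterm : ∀ a : Fin (2 * N),
      (if 0 < gap u (a + 1) then 1 / Q * (1 / gap u (a + 1) ^ 2) else 0) * κ ≤
        1 / Q * ∑ m, A.expectedCount ρ u m * u (m.1 a) ^ 2 := by
    intro a
    have h := item_lower_bound hN hfin hδ hδ' hA hu hanti a
    split_ifs with hg
    · rw [mul_assoc]
      refine mul_le_mul_of_nonneg_left ?_ (by positivity)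
      rw [one_div, inv_mul_le_iff₀ (by positivity), mul_comm]
      exact h
    · rw [zero_mul]
      exact mul_nonneg (by positivity) (Finset.sum_nonneg fun m _ =>
        mul_nonneg (A.expectedCount_nonneg ρ u m) (sq_nonneg _))
  have hindex : ∀ f : ℕ → ℝ, ∑ i ∈ Finset.Icc 1 (2 * N), f i = ∑ a : Fin (2 * N), f (a + 1) := by
    intro f
    rw [Fin.sum_univ_eq_sum_range (fun k => f (k + 1)), Finset.range_eq_Ico,
      Finset.sum_Ico_add' f 0 (2 * N) 1]
    rfl
  rw [Finset.sum_filter, hindex, Finset.sum_mul]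
  refine (Finset.sum_le_sum fun a _ => hterm a).trans_eq ?_
  rw [← Finset.mul_sum, Finset.sum_comm, ← sum_expectedCount hfin]
  -- Partners run through all items once, so a round spreads the same total `Q` over the items
  -- whichever matching is sampled.
  have hQm : ∀ m : MaxMatching N, ∑ a, A.expectedCount ρ u m * u (m.1 a) ^ 2 =
      A.expectedCount ρ u m * Q := by
    intro m
    rw [← Finset.mul_sum]
    congr 1
    exact Equiv.sum_comp m.2.1.toPerm fun j => u j ^ 2
  simp_rw [hQm]
  rw [← Finset.sum_mul]
  field_simp

/-- The bound by the contribution of a single even item. -/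
theorem pairGap_lower_bound (hN : 2 ≤ N) (hfin : A.expectedTau ρ u ≠ ⊤) (hδ : 0 < δ)
    (hδ' : δ < 1 / 2) (hA : A.IsDeltaPAC ρ δ) (hu : ∀ i, u i ∈ Set.Ioo (0 : ℝ) 1)
    (hanti : Antitone u) {s : ℕ} (hs : 1 ≤ s) (hs' : s ≤ N - 1) :
    -Real.log (4 * δ * (1 - δ)) / 2 ≤
      (A.expectedTau ρ u).toReal * (param u 1 ^ 2 * pairGap u s ^ 2) := by
  -- Item `2s` has index `2s - 1`; its partner's parameter is at most `u_1`.
  have h := item_lower_bound hN hfin hδ hδ' hA hu hanti ⟨2 * s - 1, by omega⟩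
  have h1 : 2 * s - 1 + 1 = 2 * s := by omega
  have hgap : gap u (2 * s) = pairGap u s := by
    have h2 : 2 * s ≠ 1 := by omega
    have h3 : 2 * s ≠ 2 * N := by omega
    simp [gap, pairGap, h2, h3]
  simp only [h1, hgap] at h
  refine h.trans ?_
  rw [← mul_assoc]
  refine mul_le_mul_of_nonneg_right ?_ (sq_nonneg _)
  rw [← sum_expectedCount hfin, Finset.sum_mul]
  refine Finset.sum_le_sum fun m _ => mul_le_mul_of_nonneg_left ?_ (A.expectedCount_nonneg ρ u m)
  have hp : param u 1 = u ⟨0, by omega⟩ := by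
    have h4 : 1 ≤ 2 * N := by omega
    simp [param, h4]
  rw [hp]
  exact pow_le_pow_left₀ (hu _).1.le (hanti (Fin.mk_le_of_le_val (Nat.zero_le _))) 2

end Algorithm

end MatchingBandit

end

theorem theorem7 (δ₀ : ℝ) (hδ₀ : δ₀ ∈ Set.Ioo (0 : ℝ) (1 / 2)) :
    ∃ c : ℝ, 0 < c ∧
      ∀ (N : ℕ), 2 ≤ N →
      ∀ (S : Type*) [MeasurableSpace S] (ρ : Measure S) [IsProbabilityMeasure ρ]
        (A : MatchingBandit.Algorithm N S) (δ : ℝ), 0 < δ → δ ≤ δ₀ → A.IsDeltaPAC ρ δ →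
      ∀ (u : Fin (2 * N) → ℝ), (∀ i, u i ∈ Set.Ioo (0 : ℝ) 1) → Antitone u →
        ENNReal.ofReal
            (c * (∑ i ∈ (Finset.Icc 1 (2 * N)).filter (fun i => 0 < MatchingBandit.gap u i),
              1 / (∑ j, u j ^ 2) * (1 / MatchingBandit.gap u i ^ 2)) * Real.log (1 / δ))
          ≤ A.expectedTau ρ u ∧
        (∀ s ∈ Finset.Icc 2 (N - 1),
          (∀ k ∈ Finset.Icc 2 (N - 1), MatchingBandit.pairGap u s ≤ MatchingBandit.pairGap u k) →
          ENNReal.ofReal (c * Real.log (1 / δ)) /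
              ENNReal.ofReal ((MatchingBandit.param u 1 ^ 2 + MatchingBandit.param u 2 ^ 2) *
                MatchingBandit.pairGap u s ^ 2)
            ≤ A.expectedTau ρ u) ∧
        ((∀ k ∈ Finset.Icc 1 (N - 1), MatchingBandit.pairGap u 1 ≤ MatchingBandit.pairGap u k) →
          ENNReal.ofReal (c * Real.log (1 / δ)) /
              ENNReal.ofReal (MatchingBandit.param u 1 ^ 2 * MatchingBandit.pairGap u 1 ^ 2)
            ≤ A.expectedTau ρ u) := by
  obtain ⟨c, hc, hκ⟩ := MatchingBandit.exists_mul_log_le δ₀ hδ₀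
  refine ⟨c, hc, fun N hN S _ ρ _ A δ hδ hδ' hA u hu hanti => ?_⟩
  by_cases hfin : A.expectedTau ρ u = ⊤
  · simp [hfin]
  have hδ2 : δ < 1 / 2 := hδ'.trans_lt hδ₀.2
  have hκ := hκ δ hδ hδ'
  have hpair : ∀ s x, 1 ≤ s → s ≤ N - 1 → MatchingBandit.param u 1 ^ 2 ≤ x →
      ENNReal.ofReal (c * Real.log (1 / δ)) /
        ENNReal.ofReal (x * MatchingBandit.pairGap u s ^ 2) ≤ A.expectedTau ρ u := by
    intro s x hs hs' hx
    have h := MatchingBandit.Algorithm.pairGap_lower_bound hN hfin hδ hδ2 hA hu hanti hs hs'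
    -- Multiplying out also covers a zero gap: there `h` would bound a positive number by 0, so the
    -- expectation cannot be finite.
    refine ENNReal.div_le_of_le_mul ?_
    rw [← ENNReal.ofReal_toReal hfin, ← ENNReal.ofReal_mul ENNReal.toReal_nonneg]
    refine ENNReal.ofReal_le_ofReal ((hκ.trans h).trans ?_)
    exact mul_le_mul_of_nonneg_left (mul_le_mul_of_nonneg_right hx (sq_nonneg _))
      ENNReal.toReal_nonneg
  refine ⟨?_, fun s hs _ => ?_, fun _ => ?_⟩
  · refine (ENNReal.ofReal_le_iff_le_toReal hfin).2 (le_trans ?_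
      (MatchingBandit.Algorithm.sum_gap_lower_bound hN hfin hδ hδ2 hA hu hanti))
    rw [mul_comm c, mul_assoc]
    exact mul_le_mul_of_nonneg_left hκ (Finset.sum_nonneg fun i _ => mul_nonneg
      (one_div_nonneg.2 (Finset.sum_nonneg fun j _ => sq_nonneg _))
      (one_div_nonneg.2 (sq_nonneg _)))
  · have hs := Finset.mem_Icc.1 hs
    exact hpair s _ (by omega) hs.2 (le_add_of_nonneg_right (sq_nonneg _))
  · exact hpair 1 _ le_rfl (by omega) le_rfl
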